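/- A split graph is a finite simple graph whose vertex set can be partitioned into a clique and an independent set (with arbitrary edges between them; either part may be empty). \textsc{Split Addition} (resp. \textsc{Split Deletion}) is the following problem: given a finite simple graph $G$ and an integer $k \in \mathbb{N}$, is there a set $F$ of at most $k$ edges such that $G+F$, the graph on $V(G)$ with edge set $E(G)\cup F$ (resp. $G-F$, the graph on $V(G)$ with edge set $E(G)\setminus F$), is a split graph? Theorem. Each of the problems \textsc{Split Addition} and \textsc{Split Deletion}, parameterized by $k$, admits a kernel with at most $11k+6\sqrt{2k}+4$ vertices. That is, for each of the two problems there is an algorithm that, given an instance $(G,k)$, computes in time polynomial in the size of the instance (the number of bits of the adjacency matrix of $G$ and of the binary representation of $k$) an instance $(G',k')$ of the same problem such that $(G',k')$ is a positive instance if and only if $(G,k)$ is, $G'$ has at most $11k+6\sqrt{2k}+4$ vertices, and $k'\le k$. -/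

import Mathlib

/-! ### Split graphs and the two edge modification problems -/

/-- `G` is a split graph: its vertex set is partitioned into a clique `K` and an independent set
(either part may be empty; edges between the parts are arbitrary). -/
def IsSplitGraph {V : Type*} (G : SimpleGraph V) : Prop :=
  ∃ K : Set V, G.IsClique K ∧ G.IsIndepSet Kᶜ

/-- An instance `(G, k)` of a parameterized graph problem: a finite graph on the vertices
`0, …, n - 1`, and the parameter `k`. -/
structure GraphInstance where
  n : ℕ
  graph : SimpleGraph (Fin n)
  k : ℕ

/-- `Split Addition`: is there a set `F` of at most `k` edges such that `G + F` is a split graph? -/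
def SplitAddition (I : GraphInstance) : Prop :=
  ∃ F : Finset (Sym2 (Fin I.n)), (∀ e ∈ F, ¬ e.IsDiag) ∧ F.card ≤ I.k ∧
    IsSplitGraph (I.graph ⊔ SimpleGraph.fromEdgeSet (F : Set (Sym2 (Fin I.n))))

/-- `Split Deletion`: is there a set `F` of at most `k` edges of `G` such that `G - F` is a split
graph? -/
def SplitDeletion (I : GraphInstance) : Prop :=
  ∃ F : Finset (Sym2 (Fin I.n)), (∀ e ∈ F, e ∈ I.graph.edgeSet) ∧ F.card ≤ I.k ∧
    IsSplitGraph (I.graph.deleteEdges (F : Set (Sym2 (Fin I.n))))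

/-! ### A random access machine with a step count

Structured programs over finitely many registers and finitely many arrays of natural numbers (a
program mentions only finitely many of each). The arithmetic operations are addition and truncated
subtraction, at unit cost; there is no multiplication, so that `t` steps can increase the bit
length of the numbers in memory only by `O(t)`, and polynomial time on this machine is polynomial
time on Turing machines. -/

namespace RAM

/-- A memory state: the contents of the registers and of the arrays. -/
structure State where
  reg : ℕ → ℕ
  arr : ℕ → ℕ → ℕ

/-- Arithmetic expressions. -/
inductive Exp where
  /-- a numeral -/
  | const (c : ℕ)
  /-- the contents of a register -/
  | reg (r : ℕ)
  /-- the entry of array `a` at the index that is the value of `i` -/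
  | get (a : ℕ) (i : Exp)
  | add (e f : Exp)
  /-- truncated subtraction -/
  | sub (e f : Exp)

/-- The value of an expression. -/
def Exp.eval (σ : State) : Exp → ℕ
  | .const c => c
  | .reg r => σ.reg r
  | .get a i => σ.arr a (i.eval σ)
  | .add e f => e.eval σ + f.eval σ
  | .sub e f => e.eval σ - f.eval σ

/-- The number of steps that the evaluation of an expression takes: one for each numeral, each
register access, each array access and each arithmetic operation. -/
def Exp.cost : Exp → ℕ
  | .const _ => 1
  | .reg _ => 1
  | .get _ i => i.cost + 1
  | .add e f => e.cost + f.cost + 1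
  | .sub e f => e.cost + f.cost + 1

/-- Programs. -/
inductive Prog where
  | skip
  /-- register `r` := `e` -/
  | set (r : ℕ) (e : Exp)
  /-- array `a` at index `i` := `e` -/
  | put (a : ℕ) (i e : Exp)
  | seq (c d : Prog)
  /-- if `e ≠ 0` then `c` else `d` -/
  | cond (e : Exp) (c d : Prog)
  /-- while `e ≠ 0` do `c` -/
  | loop (e : Exp) (c : Prog)

/-- Writing to a register. -/
def State.setReg (σ : State) (r x : ℕ) : State :=
  { σ with reg := Function.update σ.reg r x }

/-- Writing to an array entry. -/
def State.setArr (σ : State) (a i x : ℕ) : State :=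
  { σ with arr := Function.update σ.arr a (Function.update (σ.arr a) i x) }

/-- `Exec c σ t τ`: started in state `σ`, the program `c` halts after exactly `t` steps in
state `τ`. -/
inductive Exec : Prog → State → ℕ → State → Prop where
  | skip (σ : State) : Exec .skip σ 1 σ
  | set (r : ℕ) (e : Exp) (σ : State) :
      Exec (.set r e) σ (e.cost + 1) (σ.setReg r (e.eval σ))
  | put (a : ℕ) (i e : Exp) (σ : State) :
      Exec (.put a i e) σ (i.cost + e.cost + 1) (σ.setArr a (i.eval σ) (e.eval σ))
  | seq {c d : Prog} {σ τ ρ : State} {s t : ℕ} (hc : Exec c σ s τ) (hd : Exec d τ t ρ) :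
      Exec (.seq c d) σ (s + t) ρ
  | cond_true {e : Exp} {c d : Prog} {σ τ : State} {t : ℕ} (he : e.eval σ ≠ 0)
      (hc : Exec c σ t τ) : Exec (.cond e c d) σ (e.cost + 1 + t) τ
  | cond_false {e : Exp} {c d : Prog} {σ τ : State} {t : ℕ} (he : e.eval σ = 0)
      (hd : Exec d σ t τ) : Exec (.cond e c d) σ (e.cost + 1 + t) τ
  | loop_true {e : Exp} {c : Prog} {σ τ ρ : State} {s t : ℕ} (he : e.eval σ ≠ 0)
      (hc : Exec c σ s τ) (hl : Exec (.loop e c) τ t ρ) :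
      Exec (.loop e c) σ (e.cost + 1 + s + t) ρ
  | loop_false {e : Exp} {c : Prog} {σ : State} (he : e.eval σ = 0) :
      Exec (.loop e c) σ (e.cost + 1) σ

end RAM

/-! ### Instances in memory, and kernels -/

namespace GraphInstance

open Classical in
/-- The input state that presents `(G, k)`: register `0` holds the number `n` of vertices,
register `1` holds `k`, array `0` holds the adjacency matrix, row after row, and everything else
is `0`. -/
noncomputable def inputState (I : GraphInstance) : RAM.State where
  reg r := if r = 0 then I.n else if r = 1 then I.k else 0
  arr a i :=
    if a = 0 ∧ ∃ u v : Fin I.n, i = (u : ℕ) * I.n + (v : ℕ) ∧ I.graph.Adj u v then 1 else 0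

open Classical in
/-- The instance `(G, k)` is the output that is presented by a final state: register `0` holds the
number of vertices, register `1` holds `k`, and array `1` holds the adjacency matrix, row after
row. -/
def IsOutput (I : GraphInstance) (σ : RAM.State) : Prop :=
  σ.reg 0 = I.n ∧ σ.reg 1 = I.k ∧
    ∀ u v : Fin I.n, σ.arr 1 ((u : ℕ) * I.n + (v : ℕ)) = if I.graph.Adj u v then 1 else 0

/-- The size of an instance in bits: the entries of the adjacency matrix and the binary digits of
the parameter. -/
def size (I : GraphInstance) : ℕ := I.n ^ 2 + Nat.size I.k

end GraphInstance

/-- The parameterized problem `Q` admits a kernel with at most `f k` vertices: one program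
transforms every instance `(G, k)`, in time polynomial in the size of the instance, into an
instance `(G', k')` of `Q` that is equivalent to it, has at most `f k` vertices, and has
`k' ≤ k`. -/
def AdmitsKernel (Q : GraphInstance → Prop) (f : ℕ → ℝ) : Prop :=
  ∃ (c : RAM.Prog) (p : Polynomial ℕ), ∀ I : GraphInstance,
    ∃ (J : GraphInstance) (t : ℕ) (σ : RAM.State),
      RAM.Exec c I.inputState t σ ∧ t ≤ p.eval I.size ∧ J.IsOutput σ ∧
      (Q J ↔ Q I) ∧ (J.n : ℝ) ≤ f I.k ∧ J.k ≤ I.k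


/-!
Consider `Split Addition`, and let `C` be the clique side of a split graph obtained by adding at
most `k` edges. A vertex outside `C` has its neighbourhood in `C`, so a vertex whose neighbourhood
misses more than `k` edges is in `C`. Likewise, if putting `v` into `C` forces too many
nonneighbours of `v` into `C`, then `v` is outside, and its neighbours are in `C`. Each of the
remaining vertices has a neighbourhood that misses at most `k` edges; double counting the edges that
are missing between the two sides, one sees that all but `9 * k + 1` of these vertices can be placed
at no cost. The vertices forced into `C` only charge each remaining vertex with a weight, the number
of edges missing to them. A clique on `k + 1` vertices, pinned to the clique side by `k + 2`
independent vertices joined to it, realizes these weights, which gives at most `11 * k + 4`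
vertices.

`Split Deletion` is the same problem for the complementary graph.

The adjacency of the kernel is described by counting in the given graph. Functions that a program
computes in polynomial time are closed under arithmetic and under sums over polynomially many
indices, hence under counting. The parameter may be exponentially large in the size of the
instance, so it is first cut down to the square of the number of vertices.
-/

namespace RAM

@[simp] theorem State.setReg_reg (σ : State) (r x s : ℕ) :
    (σ.setReg r x).reg s = if s = r then x else σ.reg s := by
  simp [State.setReg, Function.update_apply]

@[simp] theorem State.setReg_arr (σ : State) (r x : ℕ) : (σ.setReg r x).arr = σ.arr := rfl

theorem State.setArr_arr (σ : State) (a i x b j : ℕ) :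
    (σ.setArr a i x).arr b j = if b = a ∧ j = i then x else σ.arr b j := by
  by_cases h : b = a
  · subst h; simp [State.setArr, Function.update_apply]
  · simp [State.setArr, h]

/-- Started in `σ`, the program `c` halts after at most `B` steps in a state that satisfies `Q`. -/
def Runs (c : Prog) (σ : State) (B : ℕ) (Q : State → Prop) : Prop :=
  ∃ τ T, Exec c σ T τ ∧ T ≤ B ∧ Q τ

theorem Runs.mono {c : Prog} {σ : State} {B B' : ℕ} {Q Q' : State → Prop} (h : Runs c σ B Q)
    (hB : B ≤ B') (hQ : ∀ τ, Q τ → Q' τ) : Runs c σ B' Q' := by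
  obtain ⟨τ, T, h1, h2, h3⟩ := h
  exact ⟨τ, T, h1, h2.trans hB, hQ _ h3⟩

theorem Runs.seq {c d : Prog} {σ : State} {B B' : ℕ} {R Q : State → Prop} (h : Runs c σ B R)
    (h' : ∀ τ, R τ → Runs d τ B' Q) : Runs (.seq c d) σ (B + B') Q := by
  obtain ⟨τ, T, h1, h2, h3⟩ := h
  obtain ⟨ρ, T', h4, h5, h6⟩ := h' τ h3
  exact ⟨ρ, T + T', .seq h1 h4, add_le_add h2 h5, h6⟩

theorem runs_set {r : ℕ} {e : Exp} {σ : State} {Q : State → Prop}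
    (h : Q (σ.setReg r (e.eval σ))) : Runs (.set r e) σ (e.cost + 1) Q :=
  ⟨_, _, .set r e σ, le_rfl, h⟩

theorem runs_put {a : ℕ} {i e : Exp} {σ : State} {Q : State → Prop}
    (h : Q (σ.setArr a (i.eval σ) (e.eval σ))) : Runs (.put a i e) σ (i.cost + e.cost + 1) Q :=
  ⟨_, _, .put a i e σ, le_rfl, h⟩

theorem runs_loop {e : Exp} {c : Prog} (N B : ℕ) (Φ : ℕ → State → Prop)
    (hstep : ∀ i < N, ∀ σ, Φ i σ → e.eval σ ≠ 0 ∧ Runs c σ B (Φ (i + 1)))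
    (hend : ∀ σ, Φ N σ → e.eval σ = 0) {σ : State} (hσ : Φ 0 σ) :
    Runs (.loop e c) σ (N * (e.cost + 1 + B) + (e.cost + 1)) (Φ N) := by
  suffices h : ∀ j i, i + j = N → ∀ σ, Φ i σ →
      Runs (.loop e c) σ (j * (e.cost + 1 + B) + (e.cost + 1)) (Φ N) from h N 0 (by simp) σ hσ
  intro j
  induction j with
  | zero =>
    intro i hi σ hσ
    obtain rfl : i = N := by simpa using hi
    exact ⟨σ, _, .loop_false (hend σ hσ), by simp, hσ⟩
  | succ j ih =>
    intro i hi σ hσ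
    obtain ⟨he, τ, T, h1, h2, h3⟩ := hstep i (by omega) σ hσ
    obtain ⟨ρ, T', h4, h5, h6⟩ := ih (i + 1) (by omega) τ h3
    refine ⟨ρ, _, .loop_true he h1 h4, ?_, h6⟩
    rw [Nat.succ_mul]
    omega

theorem runs_for {c : Prog} {r s : ℕ} (N B : ℕ) (Φ : ℕ → State → Prop)
    (hΦ : ∀ i σ, Φ i σ → σ.reg r = N ∧ σ.reg s = i)
    (hc : ∀ i < N, ∀ σ, Φ i σ →
      Runs c σ B fun τ => τ.reg s = i ∧ Φ (i + 1) (τ.setReg s (i + 1)))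
    {σ : State} (hσ : Φ 0 σ) :
    Runs (.loop (.sub (.reg r) (.reg s)) (.seq c (.set s (.add (.reg s) (.const 1))))) σ
      (N * (B + 8) + 4) (Φ N) := by
  refine (runs_loop N (B + 4) Φ (fun i hi σ hσ => ⟨?_, ?_⟩) (fun σ hσ => ?_) hσ).mono
    (by simp only [Exp.cost]; ring_nf; rfl) fun _ => id
  · simp only [Exp.eval, hΦ i σ hσ]
    omega
  · exact (hc i hi σ hσ).seq fun τ ⟨hτ, h⟩ => runs_set (by simpa only [Exp.eval, hτ] using h)
  · simp [Exp.eval, hΦ N σ hσ]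

/-- `τ` agrees with `σ` on the registers below `d` and on the arrays. -/
def State.Agree (d : ℕ) (σ τ : State) : Prop :=
  (∀ r < d, τ.reg r = σ.reg r) ∧ τ.arr = σ.arr

theorem State.Agree.refl (d : ℕ) (σ : State) : State.Agree d σ σ := ⟨fun _ _ => rfl, rfl⟩

theorem State.Agree.trans {d e : ℕ} {σ τ ρ : State} (h : State.Agree d σ τ)
    (h' : State.Agree e τ ρ) (hde : d ≤ e) : State.Agree d σ ρ :=
  ⟨fun r hr => (h'.1 r (hr.trans_le hde)).trans (h.1 r hr), h'.2.trans h.2⟩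

theorem State.Agree.setReg {d r : ℕ} {σ τ : State} (h : State.Agree d σ τ) (hr : d ≤ r) (x : ℕ) :
    State.Agree d σ (τ.setReg r x) :=
  ⟨fun s hs => by rw [State.setReg_reg, if_neg (by omega), h.1 s hs], h.2⟩

/-- Summation: `c` writes the number of summands to register `d`, and `c'` writes the summand whose
index is in register `d + 1` to register `d + 3`; the sum is written to register `d`. -/
def sumProg (d : ℕ) (c c' : Prog) : Prog :=
  .seq c <| .seq (.set (d + 1) (.const 0)) <| .seq (.set (d + 2) (.const 0)) <|
    .seq (.loop (.sub (.reg d) (.reg (d + 1))) <|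
      .seq (.seq c' (.set (d + 2) (.add (.reg (d + 2)) (.reg (d + 3)))))
        (.set (d + 1) (.add (.reg (d + 1)) (.const 1))))
      (.set d (.reg (d + 2)))

theorem runs_sum {c c' : Prog} {d N T B : ℕ} {σ : State} {f : Fin N → ℕ}
    (hc : Runs c σ T fun τ => τ.reg d = N ∧ State.Agree d σ τ)
    (hc' : ∀ (i : Fin N) τ, State.Agree d σ τ → τ.reg (d + 1) = i →
      Runs c' τ B fun ρ => ρ.reg (d + 3) = f i ∧ State.Agree (d + 3) τ ρ) :
    Runs (sumProg d c c') σ (T + (2 + (2 + (N * (B + 12) + 4 + 2))))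
      fun τ => τ.reg d = ∑ i, f i ∧ State.Agree d σ τ := by
  let Φ (i : ℕ) (τ : State) : Prop := (State.Agree d σ τ ∧
    τ.reg (d + 2) = ∑ j ∈ Finset.range i, if h : j < N then f ⟨j, h⟩ else 0) ∧
    τ.reg d = N ∧ τ.reg (d + 1) = i
  refine hc.seq fun τ ⟨hτ, hστ⟩ => (runs_set ?_).seq fun _ => id
  refine (runs_set ?_).seq fun _ => id
  refine (runs_for N (B + 4) Φ (fun i τ h => h.2) ?_ ⟨⟨?_, ?_⟩, ?_⟩).seq fun τ h => runs_set ?_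
  · rintro i hi τ ⟨⟨hστ, hsum⟩, hN, hi'⟩
    refine (hc' ⟨i, hi⟩ τ hστ hi').seq fun ρ ⟨hρ, hτρ⟩ => runs_set ?_
    have hσρ := hστ.trans hτρ (by omega)
    refine ⟨?_, ⟨(hσρ.setReg (by omega) _).setReg (by omega) _, ?_⟩, ?_, ?_⟩
    · simp [hτρ.1, hi']
    · simp [Exp.eval, hρ, hτρ.1, hsum, Finset.sum_range_succ, hi]
    · simp [hτρ.1, hN]
    · simp
  · exact (hστ.setReg (by omega) _).setReg (by omega) _
  · simp [Exp.eval]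
  · simp [Exp.eval, hτ]
  · exact ⟨by simp [Exp.eval, h.1.2, Finset.sum_fin_eq_sum_range], h.1.1.setReg le_rfl _⟩

end RAM

/-! ### Functions computable in polynomial time -/

namespace PolyTimeComputation

open Finset GraphInstance RAM

/-- The inputs of a computation: each consists of an instance, and of the values of certain
variables. -/
class Context (Γ : Type) where
  inst : Γ → GraphInstance
  Var : Type
  val : Γ → Var → ℕ

open Context

instance : Context GraphInstance := ⟨id, Empty, fun _ => Empty.elim⟩

section

variable {Γ : Type} [Context Γ]

instance (n : Γ → ℕ) : Context (Σ γ, Fin (n γ)) where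
  inst x := inst x.1
  Var := Option (Var Γ)
  val x v := v.elim x.2 (val x.1)

/-- A bound by a polynomial in the size of the instance. -/
def PolyBounded (f : Γ → ℕ) : Prop := ∃ p : Polynomial ℕ, ∀ γ, f γ ≤ p.eval (inst γ).size

theorem PolyBounded.mono {f g : Γ → ℕ} (hg : PolyBounded g) (h : ∀ γ, f γ ≤ g γ) :
    PolyBounded f :=
  hg.imp fun _ hp γ => (h γ).trans (hp γ)

theorem PolyBounded.const (c : ℕ) : PolyBounded fun _ : Γ => c :=
  ⟨Polynomial.C c, fun _ => by simp⟩

theorem PolyBounded.add {f g : Γ → ℕ} (hf : PolyBounded f) (hg : PolyBounded g) :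
    PolyBounded fun γ => f γ + g γ := by
  obtain ⟨p, hp⟩ := hf
  obtain ⟨q, hq⟩ := hg
  exact ⟨p + q, fun γ => by simpa using add_le_add (hp γ) (hq γ)⟩

theorem PolyBounded.mul {f g : Γ → ℕ} (hf : PolyBounded f) (hg : PolyBounded g) :
    PolyBounded fun γ => f γ * g γ := by
  obtain ⟨p, hp⟩ := hf
  obtain ⟨q, hq⟩ := hg
  exact ⟨p * q, fun γ => by simpa using Nat.mul_le_mul (hp γ) (hq γ)⟩

theorem PolyBounded.size : PolyBounded fun γ : Γ => (inst γ).size :=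
  ⟨Polynomial.X, fun _ => by simp⟩

theorem PolyBounded.comp_inst {f : GraphInstance → ℕ} (hf : PolyBounded f) :
    PolyBounded fun γ : Γ => f (inst γ) :=
  hf.imp fun _ hp γ => hp (inst γ)

theorem PolyBounded.comp_fst {f : Γ → ℕ} (hf : PolyBounded f) (n : Γ → ℕ) :
    PolyBounded fun x : Σ γ, Fin (n γ) => f x.1 :=
  hf.imp fun _ hp x => hp x.1

theorem PolyBounded.exists_forall_le {n : Γ → ℕ} {f : (Σ γ, Fin (n γ)) → ℕ}
    (hf : PolyBounded f) : ∃ B : Γ → ℕ, PolyBounded B ∧ ∀ γ i, f ⟨γ, i⟩ ≤ B γ := by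
  obtain ⟨p, hp⟩ := hf
  exact ⟨fun γ => p.eval (inst γ).size, ⟨p, fun _ => le_rfl⟩, fun γ i => hp ⟨γ, i⟩⟩

/-- The memory holds the input `γ`: the instance as in `GraphInstance.inputState`, and the
variable `v` in the register `a v`. -/
structure Loaded (a : Var Γ → ℕ) (γ : Γ) (σ : State) : Prop where
  n : σ.reg 0 = (inst γ).n
  k : σ.reg 1 = (inst γ).k
  adj : σ.arr 0 = (inst γ).inputState.arr 0
  val : ∀ v, σ.reg (a v) = val γ v

theorem Loaded.of_agree {a : Var Γ → ℕ} {γ : Γ} {d : ℕ} {σ τ : State} (hσ : Loaded a γ σ)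
    (h : State.Agree d σ τ) (hd : 2 ≤ d) (ha : ∀ v, a v < d) : Loaded a γ τ where
  n := (h.1 0 (by omega)).trans hσ.n
  k := (h.1 1 (by omega)).trans hσ.k
  adj := by rw [h.2, hσ.adj]
  val v := (h.1 _ (ha v)).trans (hσ.val v)

/-- `f` is bounded polynomially and computed in polynomial time. The program is to exist for all
assignments `a` of registers to variables and all destinations `d`, and preserves the registers
below `d` and the arrays, so that programs can be composed. -/
structure PolyTime (f : Γ → ℕ) : Prop where
  bounded : PolyBounded f
  runs : ∀ (a : Var Γ → ℕ) (d : ℕ), 2 ≤ d → (∀ v, a v < d) → ∃ (c : Prog) (T : Γ → ℕ),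
    PolyBounded T ∧ ∀ γ σ, Loaded a γ σ →
      Runs c σ (T γ) fun τ => τ.reg d = f γ ∧ State.Agree d σ τ

theorem PolyTime.of_eq {f g : Γ → ℕ} (hf : PolyTime f) (h : ∀ γ, g γ = f γ) : PolyTime g :=
  (funext h : g = f) ▸ hf

theorem PolyTime.of_exp {f : Γ → ℕ} (hf : PolyBounded f) (e : (Var Γ → ℕ) → Exp)
    (he : ∀ a γ σ, Loaded a γ σ → (e a).eval σ = f γ) : PolyTime f where
  bounded := hf
  runs a d _ _ := ⟨.set d (e a), fun _ => (e a).cost + 1, .const _, fun _ σ hσ =>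
    runs_set ⟨by simp [he a _ σ hσ], (State.Agree.refl d σ).setReg le_rfl _⟩⟩

theorem PolyTime.const (c : ℕ) : PolyTime fun _ : Γ => c :=
  .of_exp (.const c) (fun _ => .const c) fun _ _ _ _ => rfl

theorem PolyTime.n : PolyTime fun γ : Γ => (inst γ).n :=
  .of_exp (PolyBounded.size.mono fun _ => (Nat.le_self_pow two_ne_zero _).trans
    (Nat.le_add_right _ _)) (fun _ => .reg 0) fun _ _ _ hσ => hσ.n

theorem PolyTime.comp_inst {f : GraphInstance → ℕ} (hf : PolyTime f) :
    PolyTime fun γ : Γ => f (inst γ) where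
  bounded := hf.bounded.comp_inst
  runs a d hd _ := by
    obtain ⟨c, T, hT, hc⟩ := hf.runs Empty.elim d hd (fun v => v.elim)
    exact ⟨c, fun γ => T (inst γ), hT.comp_inst, fun γ σ hσ =>
      hc (inst γ) σ ⟨hσ.n, hσ.k, hσ.adj, fun v => v.elim⟩⟩

theorem PolyTime.comp_fst {f : Γ → ℕ} (hf : PolyTime f) (n : Γ → ℕ) :
    PolyTime fun x : Σ γ, Fin (n γ) => f x.1 where
  bounded := hf.bounded.comp_fst n
  runs a d hd ha := by
    obtain ⟨c, T, hT, hc⟩ := hf.runs (fun v => a (some v)) d hd (fun v => ha _)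
    exact ⟨c, fun x => T x.1, hT.comp_fst n, fun x σ hσ =>
      hc x.1 σ ⟨hσ.n, hσ.k, hσ.adj, fun v => hσ.val (some v)⟩⟩

theorem PolyTime.snd {n : Γ → ℕ} (hn : PolyTime n) :
    PolyTime fun x : Σ γ, Fin (n γ) => (x.2 : ℕ) :=
  .of_exp ((hn.bounded.comp_fst n).mono fun x => x.2.2.le) (fun a => .reg (a none))
    fun _ _ _ hσ => hσ.val none

theorem PolyTime.map₂ {f g h : Γ → ℕ} (hf : PolyTime f) (hg : PolyTime g) (hh : PolyBounded h)
    (e : Exp → Exp → Exp) (he : ∀ a γ σ, Loaded a γ σ → ∀ r s, σ.reg r = f γ → σ.reg s = g γ →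
      (e (.reg r) (.reg s)).eval σ = h γ) :
    PolyTime h where
  bounded := hh
  runs a d hd ha := by
    obtain ⟨c, T, hT, hc⟩ := hf.runs a d hd ha
    obtain ⟨c', T', hT', hc'⟩ := hg.runs a (d + 1) (by omega) fun v => (ha v).trans d.lt_succ_self
    let u := e (.reg d) (.reg (d + 1))
    refine ⟨.seq c (.seq c' (.set d u)), fun γ => T γ + (T' γ + (u.cost + 1)),
      hT.add (hT'.add (.const _)), fun γ σ hσ => ?_⟩
    refine (hc γ σ hσ).seq fun τ ⟨hτ, hστ⟩ => (hc' γ τ (hσ.of_agree hστ hd ha)).seq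
      fun ρ ⟨hρ, hτρ⟩ => ?_
    have hσρ := hστ.trans hτρ d.le_succ
    refine runs_set ⟨?_, hσρ.setReg le_rfl _⟩
    rw [State.setReg_reg, if_pos rfl]
    exact he a γ ρ (hσ.of_agree hσρ hd ha) d (d + 1) ((hτρ.1 d d.lt_succ_self).trans hτ) hρ

theorem PolyTime.add {f g : Γ → ℕ} (hf : PolyTime f) (hg : PolyTime g) :
    PolyTime fun γ => f γ + g γ :=
  hf.map₂ hg (hf.bounded.add hg.bounded) .add fun _ _ _ _ r s hr hs => by simp [Exp.eval, hr, hs]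

theorem PolyTime.sub {f g : Γ → ℕ} (hf : PolyTime f) (hg : PolyTime g) :
    PolyTime fun γ => f γ - g γ :=
  hf.map₂ hg (hf.bounded.mono fun _ => Nat.sub_le _ _) .sub
    fun _ _ _ _ r s hr hs => by simp [Exp.eval, hr, hs]

theorem PolyTime.input {f : Γ → ℕ} (hf : PolyTime f) :
    PolyTime fun γ => (inst γ).inputState.arr 0 (f γ) :=
  hf.map₂ hf ((PolyBounded.const 1).mono fun γ => by simp only [inputState]; split_ifs <;> simp)
    (fun e _ => .get 0 e) fun _ _ _ hσ r _ hr _ => by simp [Exp.eval, hr, hσ.adj]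

-- The parameter itself is not polynomially bounded: the size counts only its binary digits.
theorem PolyTime.min_k {f : Γ → ℕ} (hf : PolyTime f) : PolyTime fun γ => min (inst γ).k (f γ) :=
  hf.map₂ hf (hf.bounded.mono fun _ => min_le_right _ _) (fun e _ => .sub e (.sub e (.reg 1)))
    fun _ _ _ hσ r _ hr _ => by simp only [Exp.eval, hr, hσ.k]; omega

theorem PolyBounded.sum {n : Γ → ℕ} {f : (Σ γ, Fin (n γ)) → ℕ} (hn : PolyBounded n)
    (hf : PolyBounded f) : PolyBounded fun γ => ∑ i, f ⟨γ, i⟩ := by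
  obtain ⟨B, hB, hfB⟩ := hf.exists_forall_le
  exact (hn.mul hB).mono fun γ => (sum_le_card_nsmul _ _ _ fun i _ => hfB γ i).trans (by simp)

theorem PolyTime.sum {n : Γ → ℕ} {f : (Σ γ, Fin (n γ)) → ℕ} (hn : PolyTime n)
    (hf : PolyTime f) : PolyTime fun γ => ∑ i, f ⟨γ, i⟩ where
  bounded := hn.bounded.sum hf.bounded
  runs a d hd ha := by
    obtain ⟨c, T, hT, hc⟩ := hn.runs a d hd ha
    obtain ⟨c', T', hT', hc'⟩ := hf.runs (fun v => v.elim (d + 1) a) (d + 3) (by omega) <| by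
      rintro (_ | v)
      · exact Nat.lt_add_of_pos_right two_pos
      · exact (ha v).trans (by omega)
    obtain ⟨B, hB, hTB⟩ := hT'.exists_forall_le
    refine ⟨sumProg d c c', _, hT.add ((PolyBounded.const 2).add ((PolyBounded.const 2).add
      (((hn.bounded.mul (hB.add (.const 12))).add (.const 4)).add (.const 2)))),
      fun γ σ hσ => runs_sum (hc γ σ hσ) fun i τ hστ hi => ?_⟩
    have hτ := hσ.of_agree hστ hd ha
    refine (hc' ⟨γ, i⟩ τ ⟨hτ.n, hτ.k, hτ.adj, ?_⟩).mono (hTB γ i) fun _ => id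
    rintro (_ | v)
    · exact hi
    · exact hτ.val v

theorem PolyTime.mul {f g : Γ → ℕ} (hf : PolyTime f) (hg : PolyTime g) :
    PolyTime fun γ => f γ * g γ :=
  (hf.sum (hg.comp_fst f)).of_eq fun γ => by simp

open Classical in
/-- The predicate `p` is decidable in polynomial time. -/
def PolyTimePred (p : Γ → Prop) : Prop := PolyTime fun γ => if p γ then 1 else 0

theorem PolyTimePred.of_iff {p q : Γ → Prop} (hp : PolyTimePred p) (h : ∀ γ, q γ ↔ p γ) :
    PolyTimePred q :=
  (funext fun γ => propext (h γ) : q = p) ▸ hp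

theorem PolyTimePred.comp_inst {p : GraphInstance → Prop} (hp : PolyTimePred p) :
    PolyTimePred fun γ : Γ => p (inst γ) :=
  PolyTime.comp_inst hp

theorem PolyTimePred.not {p : Γ → Prop} (hp : PolyTimePred p) : PolyTimePred fun γ => ¬ p γ :=
  ((PolyTime.const 1).sub hp).of_eq fun γ => by by_cases h : p γ <;> simp [h]

theorem PolyTimePred.and {p q : Γ → Prop} (hp : PolyTimePred p) (hq : PolyTimePred q) :
    PolyTimePred fun γ => p γ ∧ q γ :=
  (PolyTime.mul hp hq).of_eq fun γ => by split_ifs <;> simp_all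

theorem PolyTimePred.or {p q : Γ → Prop} (hp : PolyTimePred p) (hq : PolyTimePred q) :
    PolyTimePred fun γ => p γ ∨ q γ :=
  (hp.not.and hq.not).not.of_iff fun _ => by tauto

theorem PolyTime.ite {p : Γ → Prop} [DecidablePred p] {f g : Γ → ℕ} (hp : PolyTimePred p)
    (hf : PolyTime f) (hg : PolyTime g) : PolyTime fun γ => if p γ then f γ else g γ :=
  ((PolyTime.mul hp hf).add (PolyTime.mul hp.not hg)).of_eq fun γ => by
    by_cases h : p γ <;> simp [h]

theorem PolyTimePred.ite {p q r : Γ → Prop} [DecidablePred p] (hp : PolyTimePred p)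
    (hq : PolyTimePred q) (hr : PolyTimePred r) :
    PolyTimePred fun γ => if p γ then q γ else r γ :=
  ((hp.and hq).or (hp.not.and hr)).of_iff fun γ => by by_cases h : p γ <;> simp [h]

theorem PolyTime.lt {f g : Γ → ℕ} (hf : PolyTime f) (hg : PolyTime g) :
    PolyTimePred fun γ => f γ < g γ :=
  ((PolyTime.const 1).sub ((PolyTime.const 1).sub (hg.sub hf))).of_eq fun γ => by
    split_ifs <;> omega

theorem PolyTime.le {f g : Γ → ℕ} (hf : PolyTime f) (hg : PolyTime g) :
    PolyTimePred fun γ => f γ ≤ g γ :=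
  (hg.lt hf).not.of_iff fun _ => not_lt.symm

theorem PolyTime.eq {f g : Γ → ℕ} (hf : PolyTime f) (hg : PolyTime g) :
    PolyTimePred fun γ => f γ = g γ :=
  ((hf.le hg).and (hg.le hf)).of_iff fun _ => le_antisymm_iff

theorem PolyTime.exists_fin {n : Γ → ℕ} {p : (γ : Γ) → Fin (n γ) → Prop} (hn : PolyTime n)
    (hp : PolyTimePred fun x : Σ γ, Fin (n γ) => p x.1 x.2) :
    PolyTimePred fun γ => ∃ i, p γ i :=
  ((PolyTime.const 0).lt (hn.sum hp)).of_iff fun γ => by simp [Finset.Nonempty]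

theorem PolyTime.sum_mem {n : Γ → ℕ} {S : (γ : Γ) → Finset (Fin (n γ))}
    {f : (γ : Γ) → Fin (n γ) → ℕ} (hn : PolyTime n)
    (hS : PolyTimePred fun x : Σ γ, Fin (n γ) => x.2 ∈ S x.1)
    (hf : PolyTime fun x : Σ γ, Fin (n γ) => f x.1 x.2) :
    PolyTime fun γ => ∑ i ∈ S γ, f γ i :=
  (hn.sum (PolyTime.mul hS hf)).of_eq fun γ => by simp

theorem PolyTime.card {n : Γ → ℕ} {S : (γ : Γ) → Finset (Fin (n γ))} (hn : PolyTime n)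
    (hS : PolyTimePred fun x : Σ γ, Fin (n γ) => x.2 ∈ S x.1) : PolyTime fun γ => #(S γ) :=
  (hn.sum_mem hS (.const 1)).of_eq fun _ => card_eq_sum_ones _

theorem PolyTime.div {f g : Γ → ℕ} (hf : PolyTime f) (hg : PolyTime g) :
    PolyTime fun γ => f γ / g γ := by
  let S (γ : Γ) : Finset (Fin (f γ)) := {i | 0 < g γ ∧ (i + 1) * g γ ≤ f γ}
  have hS : PolyTimePred fun x : Σ γ, Fin (f γ) => x.2 ∈ S x.1 := by
    simp only [S, mem_filter_univ]
    exact ((PolyTime.const 0).lt (hg.comp_fst f)).and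
      (((hf.snd.add (.const 1)).mul (hg.comp_fst f)).le (hf.comp_fst f))
  refine (hf.card hS).of_eq fun γ => ?_
  rcases (g γ).eq_zero_or_pos with h | h
  · simp [S, h]
  · have : S γ = univ.filter fun i : Fin (f γ) => (i : ℕ) < f γ / g γ := by
      ext i
      rw [mem_filter_univ, mem_filter_univ, and_iff_right h, ← Nat.le_div_iff_mul_le h,
        Nat.lt_iff_add_one_le]
    rw [this, Fin.card_filter_val_lt, min_eq_right (Nat.div_le_self _ _)]

/-- Adjacency in the graph of an instance, of vertices given as natural numbers. -/
def NatAdj (I : GraphInstance) (x y : ℕ) : Prop := ∃ u v, I.graph.Adj u v ∧ x = u ∧ y = v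

@[simp] theorem natAdj_val {I : GraphInstance} {u v : Fin I.n} :
    NatAdj I u v ↔ I.graph.Adj u v := by
  simp [NatAdj, Fin.val_inj]

theorem natAdj_iff {I : GraphInstance} {x y : ℕ} (hx : x < I.n) (hy : y < I.n) :
    NatAdj I x y ↔ I.graph.Adj ⟨x, hx⟩ ⟨y, hy⟩ :=
  natAdj_val (u := ⟨x, hx⟩) (v := ⟨y, hy⟩)

theorem not_natAdj {I : GraphInstance} {x y : ℕ} (h : ¬ (x < I.n ∧ y < I.n)) : ¬ NatAdj I x y :=
  fun ⟨u, v, _, hu, hv⟩ => h ⟨hu ▸ u.2, hv ▸ v.2⟩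

theorem mul_add_inj {n : ℕ} {u v u' v' : Fin n} :
    (u : ℕ) * n + v = u' * n + v' ↔ u = u' ∧ v = v' := by
  have h : finProdFinEquiv (u, v) = finProdFinEquiv (u', v') ↔ u = u' ∧ v = v' := by simp
  rwa [Fin.ext_iff, finProdFinEquiv_apply_val, finProdFinEquiv_apply_val, add_comm, mul_comm,
    add_comm (v' : ℕ), mul_comm n] at h

open Classical in
theorem inputState_arr_zero (I : GraphInstance) (u v : Fin I.n) :
    I.inputState.arr 0 (u * I.n + v) = if I.graph.Adj u v then 1 else 0 := by
  refine if_congr ⟨?_, fun h => ⟨rfl, u, v, rfl, h⟩⟩ rfl rfl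
  rintro ⟨-, u', v', huv, h⟩
  obtain ⟨rfl, rfl⟩ := mul_add_inj.1 huv
  exact h

theorem PolyTime.natAdj {f g : Γ → ℕ} (hf : PolyTime f) (hg : PolyTime g) :
    PolyTimePred fun γ => NatAdj (inst γ) (f γ) (g γ) := by
  classical
  refine (((hf.lt .n).and (hg.lt .n)).and
    (((hf.mul .n).add hg).input.eq (.const 1))).of_iff fun γ => ?_
  by_cases h : f γ < (inst γ).n ∧ g γ < (inst γ).n
  · have := inputState_arr_zero (inst γ) ⟨f γ, h.1⟩ ⟨g γ, h.2⟩
    simp_all [natAdj_iff]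
  · simp [h, not_natAdj]

/-- The transformation `J` of instances is computable in polynomial time: so are the number of
vertices and the parameter of `J I`, and the adjacency of `J I` for computable vertices. -/
structure PolyTimeTransform (J : GraphInstance → GraphInstance) : Prop where
  n : PolyTime fun I => (J I).n
  k : PolyTime fun I => (J I).k
  adj : ∀ {Γ : Type} [Context Γ] {f g : Γ → ℕ}, PolyTime f → PolyTime g →
    PolyTimePred fun γ => NatAdj (J (inst γ)) (f γ) (g γ)

end

/-- The restriction of the parameter to values at which not all pairs of vertices can be edited. -/
def trunc (I : GraphInstance) : GraphInstance := ⟨I.n, I.graph, min I.k (I.n * I.n)⟩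

theorem PolyTimeTransform.trunc : PolyTimeTransform trunc where
  n := .n
  k := (PolyTime.n.mul .n).min_k
  adj := PolyTime.natAdj

/-- The instance with the complementary graph. -/
def compl (I : GraphInstance) : GraphInstance := ⟨I.n, I.graphᶜ, I.k⟩

theorem compl_involutive : Function.Involutive compl := fun I => by
  rw [compl, compl, compl_compl]

theorem natAdj_compl {I : GraphInstance} {x y : ℕ} :
    NatAdj (compl I) x y ↔ (x < I.n ∧ y < I.n) ∧ x ≠ y ∧ ¬ NatAdj I x y := by
  by_cases h : x < I.n ∧ y < I.n
  · rw [natAdj_iff (I := compl I) h.1 h.2, natAdj_iff h.1 h.2]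
    simp [compl, h]
  · simp [h, not_natAdj (I := compl I) h]

theorem PolyTimeTransform.compl {J : GraphInstance → GraphInstance} (hJ : PolyTimeTransform J) :
    PolyTimeTransform fun I => compl (J I) where
  n := hJ.n
  k := hJ.k
  adj hf hg := (((hf.lt hJ.n.comp_inst).and (hg.lt hJ.n.comp_inst)).and
    ((hf.eq hg).not.and (hJ.adj hf hg).not)).of_iff fun _ => natAdj_compl

theorem PolyTimeTransform.ite {p : GraphInstance → Prop} [DecidablePred p]
    {J K : GraphInstance → GraphInstance} (hp : PolyTimePred p) (hJ : PolyTimeTransform J)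
    (hK : PolyTimeTransform K) : PolyTimeTransform fun I => if p I then J I else K I where
  n := (PolyTime.ite hp hJ.n hK.n).of_eq fun I => by split_ifs <;> rfl
  k := (PolyTime.ite hp hJ.k hK.k).of_eq fun I => by split_ifs <;> rfl
  adj hf hg := (hp.comp_inst.ite (hJ.adj hf hg) (hK.adj hf hg)).of_iff fun γ => by
    split_ifs <;> rfl

theorem Loaded.inputState (I : GraphInstance) : Loaded Empty.elim I I.inputState :=
  ⟨rfl, rfl, rfl, fun v => v.elim⟩

theorem Loaded.setReg {I : GraphInstance} {σ : State} (h : Loaded Empty.elim I σ) {r : ℕ}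
    (hr : 2 ≤ r) (x : ℕ) : Loaded Empty.elim I (σ.setReg r x) :=
  h.of_agree ((State.Agree.refl 2 σ).setReg hr x) le_rfl fun v => v.elim

theorem Loaded.runs_put {I : GraphInstance} {σ : State} (hσ : Loaded Empty.elim I σ) {c : Prog}
    {B x : ℕ} (hc : Runs c σ B fun τ => τ.reg 4 = x ∧ State.Agree 4 σ τ) :
    Runs (.seq c (.put 1 (.reg 3) (.reg 4))) σ (B + 3) fun τ => Loaded Empty.elim I τ ∧
      (∀ r < 4, τ.reg r = σ.reg r) ∧ ∀ j, τ.arr 1 j = if j = σ.reg 3 then x else σ.arr 1 j := by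
  refine hc.seq fun τ ⟨hx, hστ⟩ => RAM.runs_put ⟨⟨?_, ?_, ?_, fun v => v.elim⟩, hστ.1, fun j => ?_⟩
  · exact (hστ.1 0 (by simp)).trans hσ.n
  · exact (hστ.1 1 (by simp)).trans hσ.k
  · simp [funext_iff, State.setArr_arr, hστ.2, hσ.adj]
  · simp [State.setArr_arr, Exp.eval, hx, hστ.1, hστ.2]

theorem PolyTime.fill {n : GraphInstance → ℕ} {f : (Σ I, Fin (n I)) → ℕ} (hn : PolyTime n)
    (hf : PolyTime f) : ∃ (c : Prog) (T : GraphInstance → ℕ), PolyBounded T ∧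
      ∀ I σ, Loaded Empty.elim I σ →
        Runs c σ (T I) fun τ => Loaded Empty.elim I τ ∧
          ∀ i : Fin (n I), τ.arr 1 i = f ⟨I, i⟩ := by
  obtain ⟨c, T, hT, hc⟩ := hn.runs Empty.elim 2 le_rfl fun v => v.elim
  obtain ⟨c', T', hT', hc'⟩ := hf.runs (fun _ => 3) 4 (by norm_num) fun _ => by norm_num
  obtain ⟨B, hB, hTB⟩ := hT'.exists_forall_le
  refine ⟨.seq c (.seq (.set 3 (.const 0)) (.loop (.sub (.reg 2) (.reg 3)) (.seq
      (.seq c' (.put 1 (.reg 3) (.reg 4))) (.set 3 (.add (.reg 3) (.const 1)))))),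
    fun I => T I + (2 + (n I * (B I + 3 + 8) + 4)),
    hT.add ((PolyBounded.const 2).add ((hn.bounded.mul (hB.add (.const 11))).add (.const 4))),
    fun I σ hσ => ?_⟩
  let Φ (i : ℕ) (τ : State) : Prop :=
    (Loaded Empty.elim I τ ∧ ∀ j : Fin (n I), j < i → τ.arr 1 j = f ⟨I, j⟩) ∧
      τ.reg 2 = n I ∧ τ.reg 3 = i
  refine (hc I σ hσ).seq fun τ ⟨hτ, hστ⟩ => (runs_set (e := .const 0) (Q := Φ 0) ?_).seq fun τ h =>
    (runs_for (n I) (B I + 3) Φ (fun i τ h => h.2) ?_ h).mono le_rfl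
      fun ρ h => ⟨h.1.1, fun i => h.1.2 i i.2⟩
  · exact ⟨⟨(hσ.of_agree hστ le_rfl fun v => v.elim).setReg (by norm_num) _,
      fun j hj => absurd hj (Nat.not_lt_zero j)⟩, by simpa using hτ, by simp [Exp.eval]⟩
  · rintro i hi τ ⟨⟨hτ, hf⟩, h2, h3⟩
    have hτ' : Loaded (Γ := Σ I, Fin (n I)) (fun _ => 3) ⟨I, i, hi⟩ τ :=
      ⟨hτ.n, hτ.k, hτ.adj, by rintro (_ | v); exacts [h3, v.elim]⟩
    refine (hτ.runs_put ((hc' _ τ hτ').mono (hTB I _) fun _ => id)).mono le_rfl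
      fun ρ ⟨hρ, hreg, harr⟩ => ⟨(hreg 3 (by simp)).trans h3, ⟨hρ.setReg (by simp) _, ?_⟩, ?_⟩
    · intro j hj
      rw [State.setReg_arr, harr, h3]
      split_ifs with h
      · congr! 2
        exact Fin.ext h.symm
      · exact hf j (by omega)
    · simpa using (hreg 2 (by simp)).trans h2

theorem PolyTimeTransform.exists_exec {J : GraphInstance → GraphInstance}
    (hJ : PolyTimeTransform J) : ∃ (c : Prog) (p : Polynomial ℕ), ∀ I : GraphInstance,
      ∃ (t : ℕ) (σ : State), Exec c I.inputState t σ ∧ t ≤ p.eval I.size ∧ (J I).IsOutput σ := by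
  classical
  have hN : PolyTime fun I => (J I).n * (J I).n := hJ.n.mul hJ.n
  have hrow := hN.snd.div (hJ.n.comp_fst _)
  have hcol := hN.snd.sub (hrow.mul (hJ.n.comp_fst _))
  obtain ⟨c, T, ⟨p, hp⟩, hc⟩ := hN.fill (hJ.adj hrow hcol)
  obtain ⟨c₂, T₂, ⟨p₂, hp₂⟩, hc₂⟩ := hJ.n.runs Empty.elim 2 le_rfl fun v => v.elim
  obtain ⟨c₃, T₃, ⟨p₃, hp₃⟩, hc₃⟩ := hJ.k.runs Empty.elim 3 (by simp) fun v => v.elim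
  refine ⟨.seq c (.seq c₂ (.seq c₃ (.seq (.set 0 (.reg 2)) (.set 1 (.reg 3))))),
    p + (p₂ + (p₃ + 4)), fun I => ?_⟩
  suffices h : Runs _ I.inputState _ (J I).IsOutput by
    obtain ⟨σ, t, h, ht, hσ⟩ := h
    exact ⟨t, σ, h, ht, hσ⟩
  refine ((hc I _ (.inputState I)).seq fun τ ⟨hIτ, hτ⟩ => (hc₂ I τ hIτ).seq fun ρ ⟨hρ, hτρ⟩ =>
    (hc₃ I ρ (hIτ.of_agree hτρ le_rfl fun v => v.elim)).seq fun π ⟨hπ, hρπ⟩ =>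
      (runs_set rfl).seq fun _ h => runs_set ?_).mono ?_ fun _ => id
  · subst h
    have harr := (hρπ.2.trans hτρ.2).symm ▸ hτ
    refine ⟨?_, by simp [Exp.eval, hπ], fun u v => ?_⟩
    · simp [Exp.eval, hρπ.1, hρ]
    · have huv : (u : ℕ) * (J I).n + v < (J I).n * (J I).n := by nlinarith [u.2, v.2]
      have hu : ((u : ℕ) * (J I).n + v) / (J I).n = u := by
        rw [mul_comm, Nat.mul_add_div u.pos, Nat.div_eq_of_lt v.2, add_zero]
      simpa [hu, inst] using harr ⟨_, huv⟩
  · simp only [Polynomial.eval_add, Polynomial.eval_ofNat]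
    exact add_le_add (hp I) (add_le_add (hp₂ I) (add_le_add (hp₃ I) le_rfl))

end PolyTimeComputation

/-! ### Split completions with few added edges -/

namespace SplitKernel

open Finset

section CliqueSide

variable {V W : Type*} [DecidableEq V] [DecidableEq W]
  {G : SimpleGraph V} [DecidableRel G.Adj] {H : SimpleGraph W} [DecidableRel H.Adj]

/-- The vertices of `S` that are different from `v` and not adjacent to `v`. -/
def nonNbr (G : SimpleGraph V) [DecidableRel G.Adj] (v : V) (S : Finset V) : Finset V :=
  S.filter fun u => u ≠ v ∧ ¬ G.Adj v u

/-- The number of ordered pairs of distinct nonadjacent vertices in `S`, which is twice the number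
of edges that turn `S` into a clique. -/
def miss (G : SimpleGraph V) [DecidableRel G.Adj] (S : Finset V) : ℕ := ∑ v ∈ S, #(nonNbr G v S)

/-- `C` is the clique side of a split graph that is obtained from `G` by adding at most `k`
edges. -/
def IsCliqueSide (G : SimpleGraph V) [DecidableRel G.Adj] (C : Finset V) (k : ℕ) : Prop :=
  (∀ u ∉ C, ∀ v ∉ C, ¬ G.Adj u v) ∧ miss G C ≤ 2 * k

/-- The weighted version of `IsCliqueSide`, in which a vertex `v` of the clique side costs another
`w v` edges. -/
def IsWeightedCliqueSide (G : SimpleGraph V) [DecidableRel G.Adj] (w : V → ℕ) (C : Finset V)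
    (k : ℕ) : Prop :=
  (∀ u ∉ C, ∀ v ∉ C, ¬ G.Adj u v) ∧ miss G C + 2 * ∑ v ∈ C, w v ≤ 2 * k

theorem mem_nonNbr {v u : V} {S : Finset V} :
    u ∈ nonNbr G v S ↔ u ∈ S ∧ u ≠ v ∧ ¬ G.Adj v u := by
  rw [nonNbr, mem_filter]

theorem nonNbr_mono {S T : Finset V} (h : S ⊆ T) (v : V) : nonNbr G v S ⊆ nonNbr G v T :=
  filter_subset_filter _ h

theorem nonNbr_map (f : G ↪g H) (v : V) (S : Finset V) :
    nonNbr H (f v) (S.map f.toEmbedding) = (nonNbr G v S).map f.toEmbedding := by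
  rw [nonNbr, filter_map]
  simp [nonNbr]

theorem card_nonNbr_union {S T : Finset V} (h : Disjoint S T) (v : V) :
    #(nonNbr G v (S ∪ T)) = #(nonNbr G v S) + #(nonNbr G v T) := by
  rw [nonNbr, filter_union, card_union_of_disjoint (disjoint_filter_filter h)]
  rfl

theorem sum_card_nonNbr_comm (S T : Finset V) :
    ∑ v ∈ S, #(nonNbr G v T) = ∑ u ∈ T, #(nonNbr G u S) := by
  simp only [nonNbr, card_filter]
  rw [sum_comm]
  simp only [G.adj_comm, ne_comm]

theorem miss_map (f : G ↪g H) (S : Finset V) : miss H (S.map f.toEmbedding) = miss G S := by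
  rw [miss, sum_map]
  exact sum_congr rfl fun v _ => (congrArg card (nonNbr_map f v S)).trans (card_map _)

theorem miss_union {S T : Finset V} (h : Disjoint S T) :
    miss G (S ∪ T) = miss G S + miss G T + 2 * ∑ v ∈ S, #(nonNbr G v T) := by
  have hST := sum_card_nonNbr_comm (G := G) S T
  simp only [miss, sum_union h, card_nonNbr_union h, sum_add_distrib]
  omega

theorem miss_mono {S T : Finset V} (h : S ⊆ T) : miss G S ≤ miss G T :=
  (sum_le_sum fun v _ => card_le_card (nonNbr_mono h v)).trans (sum_le_sum_of_subset h)

theorem miss_of_isClique {S : Finset V} (h : G.IsClique S) : miss G S = 0 := by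
  refine sum_eq_zero fun v hv => card_eq_zero.2 (eq_empty_of_forall_notMem fun u hu => ?_)
  obtain ⟨huS, huv, hvu⟩ := mem_nonNbr.1 hu
  exact hvu (h hv huS huv.symm)

theorem miss_of_isIndepSet {S : Finset V} (h : G.IsIndepSet S) : miss G S = #S * (#S - 1) := by
  rw [miss, sum_congr rfl (g := fun _ => #S - 1), sum_const, smul_eq_mul]
  intro v hv
  rw [← card_erase_of_mem hv]
  congr 1
  ext u
  rw [mem_nonNbr, mem_erase]
  exact ⟨fun hu => ⟨hu.2.1, hu.1⟩, fun hu => ⟨hu.2, hu.1, h hv hu.2 hu.1.symm⟩⟩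

theorem two_mul_card_nonNbr_le_miss {S : Finset V} {v : V} (hv : v ∈ S) :
    2 * #(nonNbr G v S) ≤ miss G S := by
  have h := miss_union (G := G) (disjoint_singleton_left.2 (notMem_erase v S))
  have h_erase : nonNbr G v (S.erase v) = nonNbr G v S := by
    ext u
    simp only [mem_nonNbr, mem_erase]
    tauto
  rw [← insert_eq, insert_erase hv, sum_singleton, h_erase] at h
  omega

theorem IsCliqueSide.card_nonNbr_le {C : Finset V} {k : ℕ} (hC : IsCliqueSide G C k) {v : V}
    (hv : v ∈ C) : #(nonNbr G v C) ≤ k := by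
  have h_two := two_mul_card_nonNbr_le_miss (G := G) hv
  have h_miss := hC.2
  omega

theorem IsCliqueSide.map {C : Finset V} {k : ℕ} (hC : IsCliqueSide G C k) (e : G ≃g H) :
    IsCliqueSide H (C.map e.toEquiv.toEmbedding) k := by
  refine ⟨fun u hu v hv huv => ?_, (miss_map e.toEmbedding C).trans_le hC.2⟩
  rw [← e.apply_symm_apply u] at hu huv
  rw [← e.apply_symm_apply v] at hv huv
  exact hC.1 _ (fun h => hu (mem_map_of_mem _ h)) _ (fun h => hv (mem_map_of_mem _ h))
    (e.map_adj_iff.1 huv)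

theorem exists_isCliqueSide_congr (e : G ≃g H) (k : ℕ) :
    (∃ C, IsCliqueSide G C k) ↔ ∃ C, IsCliqueSide H C k :=
  ⟨fun ⟨_, hC⟩ => ⟨_, hC.map e⟩, fun ⟨_, hC⟩ => ⟨_, hC.map e.symm⟩⟩

/-- The graph of the edges that are missing in `S`. -/
def missGraph (G : SimpleGraph V) (S : Finset V) : SimpleGraph V where
  Adj u v := u ∈ S ∧ v ∈ S ∧ u ≠ v ∧ ¬ G.Adj u v
  symm := ⟨fun _ _ h => ⟨h.2.1, h.1, h.2.2.1.symm, fun h' => h.2.2.2 h'.symm⟩⟩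

instance (S : Finset V) : DecidableRel (missGraph G S).Adj := fun u v =>
  inferInstanceAs (Decidable (u ∈ S ∧ v ∈ S ∧ u ≠ v ∧ ¬ G.Adj u v))

theorem neighborFinset_missGraph [Fintype V] (S : Finset V) (v : V) :
    (missGraph G S).neighborFinset v = if v ∈ S then nonNbr G v S else ∅ := by
  ext u
  rw [SimpleGraph.mem_neighborFinset]
  split_ifs with hv
  · simp only [missGraph, mem_nonNbr, hv, true_and, ne_comm]
  · simp [missGraph, hv]

theorem miss_eq_two_mul [Fintype V] (S : Finset V) :
    miss G S = 2 * #(missGraph G S).edgeFinset := by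
  simp only [← SimpleGraph.sum_degrees_eq_twice_card_edges, miss,
    ← SimpleGraph.card_neighborFinset_eq_degree, neighborFinset_missGraph, apply_ite card,
    card_empty, sum_ite_mem, univ_inter]

theorem IsCliqueSide.exists_edges [Finite V] {C : Finset V} {k : ℕ} (hC : IsCliqueSide G C k) :
    ∃ F : Finset (Sym2 V), (∀ e ∈ F, ¬ e.IsDiag) ∧ #F ≤ k ∧
      IsSplitGraph (G ⊔ SimpleGraph.fromEdgeSet (F : Set (Sym2 V))) := by
  cases nonempty_fintype V
  obtain ⟨hindep, hmiss⟩ := hC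
  rw [miss_eq_two_mul] at hmiss
  refine ⟨(missGraph G C).edgeFinset, fun e he => ?_, by omega, C, fun u hu v hv huv => ?_,
    fun u hu v hv _ huv => ?_⟩
  · exact SimpleGraph.not_isDiag_of_mem_edgeSet _ (SimpleGraph.mem_edgeFinset.1 he)
  · rw [SimpleGraph.coe_edgeFinset, SimpleGraph.fromEdgeSet_edgeSet, SimpleGraph.sup_adj]
    exact or_iff_not_imp_left.2 fun h => ⟨hu, hv, huv, h⟩
  · rw [SimpleGraph.coe_edgeFinset, SimpleGraph.fromEdgeSet_edgeSet, SimpleGraph.sup_adj] at huv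
    exact huv.elim (hindep u hu v hv) fun h => hu h.1

theorem exists_isCliqueSide_of_edges [Finite V] {k : ℕ} {F : Finset (Sym2 V)} (hF : #F ≤ k)
    (h : IsSplitGraph (G ⊔ SimpleGraph.fromEdgeSet (F : Set (Sym2 V)))) :
    ∃ C, IsCliqueSide G C k := by
  classical
  cases nonempty_fintype V
  obtain ⟨K, hclique, hindep⟩ := h
  refine ⟨univ.filter (· ∈ K), fun u hu v hv huv => ?_, ?_⟩
  · rw [mem_filter_univ] at hu hv
    exact hindep hu hv huv.ne (Or.inl huv)
  rw [miss_eq_two_mul]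
  refine Nat.mul_le_mul_left 2 ((card_le_card fun e => ?_).trans hF)
  induction e with | _ u v
  intro he
  rw [SimpleGraph.mem_edgeFinset, SimpleGraph.mem_edgeSet] at he
  obtain ⟨hu, hv, huv, hnot⟩ := he
  rw [mem_filter_univ] at hu hv
  exact ((SimpleGraph.fromEdgeSet_adj _).1 ((hclique hu hv huv).resolve_left hnot)).1

end CliqueSide

/-! ### Forced vertices and the core -/

section Core

variable {V : Type*} [DecidableEq V] [Fintype V] (G : SimpleGraph V) [DecidableRel G.Adj] (k : ℕ)

/-- The vertices whose neighbourhood misses more than `k` edges. A vertex outside the clique side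
has its neighbourhood inside, so these belong to every clique side. -/
def denseForced : Finset V := univ.filter fun v => 2 * k < miss G (G.neighborFinset v)

/-- The vertices that have more than `k` nonneighbours `u` for which more than `k` of the
nonneighbours are adjacent to `u`. If such a vertex is on the clique side, then so are these `u`,
so it is on no clique side. -/
def forcedOut : Finset V := univ.filter fun v =>
  k < #((nonNbr G v univ).filter fun u => k < #((nonNbr G v univ).filter (G.Adj u)))

/-- The vertices that are found to be on every clique side. -/
def forcedIn : Finset V :=
  univ.filter fun v => v ∈ denseForced G k ∨ ∃ u, G.Adj v u ∧ u ∈ forcedOut G k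

/-- The vertices that are not forced to either side. -/
def free : Finset V := univ.filter fun v => v ∉ forcedIn G k ∧ v ∉ forcedOut G k

/-- The free vertices with a free neighbour. The other vertices that are not in `forcedIn` can be
put on the independent side. -/
def linked : Finset V := (free G k).filter fun v => ∃ u, G.Adj v u ∧ u ∈ free G k

/-- The number of vertices of `forcedIn` that are not adjacent to `v`, which is the number of edges
between `v` and these vertices to be added if `v` is put on the clique side. -/
def weight (v : V) : ℕ := #(nonNbr G v (forcedIn G k))

/-- The linked vertices that miss an edge to a forced or linked vertex. The other linked vertices
can be put on the clique side at no cost; the core is the part of the graph that is kept. -/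
def core : Finset V :=
  (linked G k).filter fun v => 0 < weight G k v ∨ ∃ u, u ≠ v ∧ u ∈ linked G k ∧ ¬ G.Adj v u

/-- The subgraph of `G` that is induced on the core. -/
def coreGraph : SimpleGraph (core G k) := G.comap (↑)

instance : DecidableRel (coreGraph G k).Adj := inferInstanceAs (DecidableRel (G.comap _).Adj)

variable {G k} {C : Finset V}

theorem mem_forcedIn {v : V} :
    v ∈ forcedIn G k ↔ v ∈ denseForced G k ∨ ∃ u, G.Adj v u ∧ u ∈ forcedOut G k :=
  mem_filter_univ v

theorem mem_linked {v : V} :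
    v ∈ linked G k ↔ v ∈ free G k ∧ ∃ u, G.Adj v u ∧ u ∈ free G k :=
  mem_filter

theorem mem_core {v : V} :
    v ∈ core G k ↔
      v ∈ linked G k ∧ (0 < weight G k v ∨ ∃ u, u ≠ v ∧ u ∈ linked G k ∧ ¬ G.Adj v u) :=
  mem_filter

theorem mem_of_mem_denseForced (hC : IsCliqueSide G C k) {v : V} (hv : v ∈ denseForced G k) :
    v ∈ C := by
  by_contra hvC
  rw [denseForced, mem_filter_univ] at hv
  refine hv.not_ge ((miss_mono fun u hu => ?_).trans hC.2)
  by_contra huC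
  exact hC.1 v hvC u huC ((G.mem_neighborFinset v u).1 hu)

theorem notMem_of_mem_forcedOut (hC : IsCliqueSide G C k) {v : V} (hv : v ∈ forcedOut G k) :
    v ∉ C := by
  intro hvC
  have h_few (S : Finset V) (hS : S ⊆ nonNbr G v univ) (hSC : S ⊆ C) : #S ≤ k :=
    (card_le_card fun u hu => mem_nonNbr.2 ⟨hSC hu, (mem_nonNbr.1 (hS hu)).2⟩).trans
      (hC.card_nonNbr_le hvC)
  rw [forcedOut, mem_filter_univ] at hv
  refine hv.not_ge (h_few _ (filter_subset _ _) fun u hu => ?_)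
  by_contra huC
  refine (mem_filter.1 hu).2.not_ge (h_few _ (filter_subset _ _) fun x hx => ?_)
  by_contra hxC
  exact hC.1 u huC x hxC (mem_filter.1 hx).2

theorem mem_of_mem_forcedIn (hC : IsCliqueSide G C k) {v : V} (hv : v ∈ forcedIn G k) :
    v ∈ C := by
  rcases mem_forcedIn.1 hv with hv | ⟨u, hvu, hu⟩
  · exact mem_of_mem_denseForced hC hv
  · by_contra hvC
    exact hC.1 v hvC u (notMem_of_mem_forcedOut hC hu) hvu

theorem miss_forcedIn_le (hC : IsCliqueSide G C k) : miss G (forcedIn G k) ≤ 2 * k :=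
  (miss_mono fun _ => mem_of_mem_forcedIn hC).trans hC.2

theorem core_subset_linked : core G k ⊆ linked G k := filter_subset _ _

theorem linked_subset_free : linked G k ⊆ free G k := filter_subset _ _

theorem disjoint_forcedIn_free : Disjoint (forcedIn G k) (free G k) :=
  disjoint_left.2 fun _ h_in h_free => (mem_filter.1 h_free).2.1 h_in

theorem disjoint_forcedIn_linked : Disjoint (forcedIn G k) (linked G k) :=
  disjoint_forcedIn_free.mono_right linked_subset_free

theorem mem_linked_of_adj {u v : V} (huv : G.Adj u v) (hu : u ∉ forcedIn G k)
    (hv : v ∉ forcedIn G k) : u ∈ linked G k := by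
  have h_out {x y : V} (hxy : G.Adj x y) (hx : x ∉ forcedIn G k) : y ∉ forcedOut G k :=
    fun hy => hx (mem_forcedIn.2 (Or.inr ⟨y, hxy, hy⟩))
  exact mem_linked.2 ⟨mem_filter.2 ⟨mem_univ u, hu, h_out huv.symm hv⟩, v, huv,
    mem_filter.2 ⟨mem_univ v, hv, h_out huv hu⟩⟩

theorem nonNbr_eq_empty_of_notMem_core {v : V} (hv : v ∈ linked G k) (hvc : v ∉ core G k) :
    nonNbr G v (forcedIn G k ∪ linked G k) = ∅ := by
  rw [mem_core] at hvc
  simp only [hv, true_and, not_or, not_exists, weight, not_lt, Nat.le_zero,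
    card_eq_zero, not_and, not_not] at hvc
  refine eq_empty_of_forall_notMem fun u hu => ?_
  obtain ⟨hu, huv, hvu⟩ := mem_nonNbr.1 hu
  rcases mem_union.1 hu with hu | hu
  · exact notMem_empty u (hvc.1 ▸ mem_nonNbr.2 ⟨hu, huv, hvu⟩)
  · exact hvu (hvc.2 u huv hu)

theorem map_subtype_core_subset (X : Finset (core G k)) :
    X.map (.subtype _) ⊆ core G k := fun _ hv => property_of_mem_map_subtype X hv

theorem miss_map_union_forcedIn (X : Finset (core G k)) :
    miss G (X.map (.subtype _) ∪ forcedIn G k) =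
      miss (coreGraph G k) X + 2 * ∑ v ∈ X, weight G k v + miss G (forcedIn G k) := by
  have h_disj : Disjoint (X.map (.subtype _)) (forcedIn G k) :=
    (disjoint_forcedIn_linked.mono_right
      ((map_subtype_core_subset X).trans core_subset_linked)).symm
  have h_core : miss G (X.map (.subtype _)) = miss (coreGraph G k) X :=
    miss_map (SimpleGraph.Embedding.comap (.subtype (· ∈ core G k)) G) X
  rw [miss_union h_disj, h_core, sum_map]
  simp only [weight, Function.Embedding.subtype_apply]
  omega

theorem miss_sdiff_core_union {S : Finset V} (hS : S ⊆ core G k ∪ forcedIn G k) :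
    miss G ((linked G k \ core G k) ∪ S) = miss G S := by
  have h_disj : Disjoint (linked G k \ core G k) S := by
    refine disjoint_left.2 fun v hv hvS => ?_
    obtain ⟨hvl, hvc⟩ := mem_sdiff.1 hv
    exact (mem_union.1 (hS hvS)).elim hvc fun h => disjoint_left.1 disjoint_forcedIn_linked h hvl
  have h_zero (v) (hv : v ∈ linked G k \ core G k) (T) (hT : T ⊆ forcedIn G k ∪ linked G k) :
      #(nonNbr G v T) = 0 := by
    obtain ⟨hvl, hvc⟩ := mem_sdiff.1 hv
    rw [card_eq_zero, ← subset_empty, ← nonNbr_eq_empty_of_notMem_core hvl hvc]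
    exact nonNbr_mono hT v
  have hS' : S ⊆ forcedIn G k ∪ linked G k :=
    hS.trans (union_comm (core G k) _ ▸ union_subset_union_right core_subset_linked)
  rw [miss_union h_disj, sum_eq_zero fun v hv => h_zero v hv S hS', miss,
    sum_eq_zero fun v hv => h_zero v hv _ (sdiff_subset.trans subset_union_right), zero_add,
    mul_zero, add_zero]

theorem IsCliqueSide.exists_core (hC : IsCliqueSide G C k) :
    ∃ X, IsWeightedCliqueSide (coreGraph G k) (fun v => weight G k v) X
      (k - miss G (forcedIn G k) / 2) := by
  refine ⟨C.subtype _, fun u hu v hv => hC.1 u (fun h => hu (mem_subtype.2 h)) v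
    fun h => hv (mem_subtype.2 h), ?_⟩
  have h_sub : (C.subtype (· ∈ core G k)).map (.subtype _) ∪ forcedIn G k ⊆ C := by
    rw [subtype_map]
    exact union_subset (filter_subset _ _) fun v => mem_of_mem_forcedIn hC
  have h_miss := (miss_mono h_sub).trans hC.2
  rw [miss_map_union_forcedIn] at h_miss
  dsimp only
  omega

theorem IsWeightedCliqueSide.exists_isCliqueSide (h_forced : miss G (forcedIn G k) ≤ 2 * k)
    {X : Finset (core G k)} (hX : IsWeightedCliqueSide (coreGraph G k) (fun v => weight G k v) X
      (k - miss G (forcedIn G k) / 2)) :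
    ∃ C, IsCliqueSide G C k := by
  obtain ⟨hindep, hmiss⟩ := hX
  refine ⟨(linked G k \ core G k) ∪ (X.map (.subtype _) ∪ forcedIn G k),
    fun u hu v hv huv => ?_, ?_⟩
  · simp only [mem_union, mem_sdiff, not_or, not_and, not_not] at hu hv
    have huc := hu.1 (mem_linked_of_adj huv hu.2.2 hv.2.2)
    have hvc := hv.1 (mem_linked_of_adj huv.symm hv.2.2 hu.2.2)
    exact hindep ⟨u, huc⟩ (fun h => hu.2.1 (mem_map_of_mem _ h)) ⟨v, hvc⟩
      (fun h => hv.2.1 (mem_map_of_mem _ h)) huv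
  · rw [miss_sdiff_core_union (union_subset_union_left (map_subtype_core_subset X)),
      miss_map_union_forcedIn]
    have h_even := miss_eq_two_mul (G := G) (forcedIn G k)
    dsimp only at hmiss
    omega

theorem exists_isCliqueSide_iff_core (h_forced : miss G (forcedIn G k) ≤ 2 * k) :
    (∃ C, IsCliqueSide G C k) ↔
      ∃ X, IsWeightedCliqueSide (coreGraph G k) (fun v => weight G k v) X
        (k - miss G (forcedIn G k) / 2) :=
  ⟨fun ⟨_, hC⟩ => hC.exists_core, fun ⟨_, hX⟩ => hX.exists_isCliqueSide h_forced⟩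

end Core

/-! ### Replacing weights by vertices -/

section Gadget

variable {V : Type*} [DecidableEq V] {G : SimpleGraph V} [DecidableRel G.Adj]
  {w : V → ℕ} {k k' : ℕ}

/-- The unweighted graph that simulates the graph `G` with the weights `w`: a clique `Q` on `k + 1`
vertices is joined completely to an independent set of `k + 2` vertices, which forces `Q` to be on
the clique side, and each `v` is not adjacent to `w v` vertices of `Q`. -/
def gadget (G : SimpleGraph V) (w : V → ℕ) (k : ℕ) :
    SimpleGraph (V ⊕ Fin (k + 1) ⊕ Fin (k + 2)) where
  Adj
    | .inl u, .inl v => G.Adj u v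
    | .inl u, .inr (.inl q) => w u ≤ q
    | .inr (.inl q), .inl u => w u ≤ q
    | .inr (.inl p), .inr (.inl q) => p ≠ q
    | .inr (.inl _), .inr (.inr _) => True
    | .inr (.inr _), .inr (.inl _) => True
    | _, _ => False
  symm := ⟨by rintro (u | p | r) (v | q | s) h <;> first | exact h.symm | exact h⟩
  loopless := ⟨by rintro (u | p | r) h; exacts [G.irrefl h, h rfl, h]⟩

instance : DecidableRel (gadget G w k).Adj := by
  rintro (u | p | r) (v | q | s) <;> dsimp only [gadget] <;> infer_instance

/-- The clique of the gadget. -/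
def gadgetClique (V : Type*) (k : ℕ) : Finset (V ⊕ Fin (k + 1) ⊕ Fin (k + 2)) :=
  univ.map (Function.Embedding.inl.trans .inr)

theorem inl_mem_map_union {X : Finset V} {v : V} :
    .inl v ∈ X.map .inl ∪ gadgetClique V k ↔ v ∈ X := by
  simp [gadgetClique]

theorem card_nonNbr_gadgetClique (v : V) :
    #(nonNbr (gadget G w k) (.inl v) (gadgetClique V k)) = min (w v) (k + 1) := by
  rw [nonNbr, gadgetClique, filter_map, card_map, min_comm, ← Fin.card_filter_val_lt]
  simp [gadget, Function.comp_def]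

theorem miss_map_union_gadgetClique (X : Finset V) :
    miss (gadget G w k) (X.map .inl ∪ gadgetClique V k) =
      miss G X + 2 * ∑ v ∈ X, min (w v) (k + 1) := by
  have h_disj : Disjoint (X.map .inl) (gadgetClique V k) := by
    simp [gadgetClique, disjoint_left]
  have h_inl : miss (gadget G w k) (X.map .inl) = miss G X :=
    miss_map (H := gadget G w k) ⟨.inl, Iff.rfl⟩ X
  have h_clique : (gadget G w k).IsClique (gadgetClique V k) := by
    simp [gadgetClique, gadget, SimpleGraph.IsClique, Set.Pairwise]
  rw [miss_union h_disj, h_inl, miss_of_isClique h_clique, sum_map]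
  simp only [Function.Embedding.inl_apply, card_nonNbr_gadgetClique, add_zero]

theorem IsCliqueSide.gadgetClique_subset {D : Finset (V ⊕ Fin (k + 1) ⊕ Fin (k + 2))}
    (hD : IsCliqueSide (gadget G w k) D k) : gadgetClique V k ⊆ D := by
  intro q hq
  by_contra hqD
  obtain ⟨q, -, rfl⟩ := mem_map.1 hq
  let R : Finset (V ⊕ Fin (k + 1) ⊕ Fin (k + 2)) := univ.map (Function.Embedding.inr.trans .inr)
  have hRD : R ⊆ D := fun r hr => by
    obtain ⟨r, -, rfl⟩ := mem_map.1 hr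
    by_contra hrD
    exact hD.1 _ hqD _ hrD trivial
  have hR : (gadget G w k).IsIndepSet R := by
    simp [R, gadget, SimpleGraph.IsIndepSet, Set.Pairwise]
  have h_miss := (miss_mono hRD).trans hD.2
  rw [miss_of_isIndepSet hR, card_map, card_univ, Fintype.card_fin] at h_miss
  change (k + 2) * (k + 1) ≤ 2 * k at h_miss
  nlinarith

theorem IsCliqueSide.exists_of_gadget (hk : k' ≤ k) {D : Finset (V ⊕ Fin (k + 1) ⊕ Fin (k + 2))}
    (hD : IsCliqueSide (gadget G w k) D k') : ∃ X, IsWeightedCliqueSide G w X k' := by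
  have hQD : gadgetClique V k ⊆ D :=
    IsCliqueSide.gadgetClique_subset ⟨hD.1, hD.2.trans (Nat.mul_le_mul_left 2 hk)⟩
  have hX : D.toLeft.map .inl ∪ gadgetClique V k ⊆ D :=
    union_subset (fun _ hv => by
      obtain ⟨_, h, rfl⟩ := mem_map.1 hv
      exact mem_toLeft.1 h) hQD
  refine ⟨D.toLeft, fun u hu v hv => hD.1 (.inl u) (fun h => hu (mem_toLeft.2 h)) (.inl v)
    fun h => hv (mem_toLeft.2 h), ?_⟩
  have h_weight : ∑ v ∈ D.toLeft, min (w v) (k + 1) = ∑ v ∈ D.toLeft, w v := by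
    refine sum_congr rfl fun v hv => ?_
    have h_le := (card_le_card (nonNbr_mono hQD (.inl v))).trans
      (hD.card_nonNbr_le (mem_toLeft.1 hv))
    rw [card_nonNbr_gadgetClique] at h_le
    omega
  have h_miss := (miss_mono hX).trans hD.2
  rwa [miss_map_union_gadgetClique, h_weight] at h_miss

theorem IsWeightedCliqueSide.gadget {X : Finset V} (hX : IsWeightedCliqueSide G w X k') :
    IsCliqueSide (gadget G w k) (X.map .inl ∪ gadgetClique V k) k' := by
  refine ⟨?_, ?_⟩
  · have hQ (q) : .inr (.inl q) ∈ X.map .inl ∪ gadgetClique V k := by simp [gadgetClique]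
    rintro (u | p | r) hu (v | q | s) hv
    · exact hX.1 u (mt inl_mem_map_union.2 hu) v (mt inl_mem_map_union.2 hv)
    all_goals first | exact absurd (hQ _) hu | exact absurd (hQ _) hv | exact id
  · rw [miss_map_union_gadgetClique]
    exact le_trans (by gcongr; exact min_le_left _ _) hX.2

theorem exists_isCliqueSide_gadget_iff (hk : k' ≤ k) :
    (∃ D, IsCliqueSide (gadget G w k) D k') ↔ ∃ X, IsWeightedCliqueSide G w X k' :=
  ⟨fun ⟨_, hD⟩ => hD.exists_of_gadget hk, fun ⟨_, hX⟩ => ⟨_, hX.gadget⟩⟩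

end Gadget

/-! ### The size of the core -/

section Count

variable {V : Type*} {G : SimpleGraph V} [DecidableRel G.Adj]

theorem le_add_one_of_mul_pred_le {q k : ℕ} (h : q * (q - 1) ≤ 2 * k) : q ≤ k + 1 := by
  by_contra! hq
  have : (k + 2) * (k + 1) ≤ q * (q - 1) := Nat.mul_le_mul (by omega) (by omega)
  nlinarith

theorem sum_sum_filter_adj (S T : Finset V) (f : V → ℕ) :
    ∑ a ∈ S, ∑ b ∈ T.filter (G.Adj a), f b = ∑ b ∈ T, #(S.filter (G.Adj b)) * f b := by
  simp only [sum_filter]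
  rw [sum_comm]
  refine sum_congr rfl fun b _ => ?_
  rw [← sum_filter, sum_const, smul_eq_mul]
  simp only [G.adj_comm]

theorem filter_adj_subset_neighborFinset [Fintype V] (a : V) (S : Finset V) :
    S.filter (G.Adj a) ⊆ G.neighborFinset a :=
  fun v hv => (G.mem_neighborFinset a v).2 (mem_filter.1 hv).2

variable [DecidableEq V]

theorem nonNbr_eq_filter {b : V} {S : Finset V} (hb : b ∉ S) :
    nonNbr G b S = S.filter fun u => ¬ G.Adj b u :=
  filter_congr fun _ hu => and_iff_right (ne_of_mem_of_not_mem hu hb)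

theorem card_filter_adj_add_card_nonNbr {b : V} {S : Finset V} (hb : b ∉ S) :
    #(S.filter (G.Adj b)) + #(nonNbr G b S) = #S := by
  rw [nonNbr_eq_filter hb, card_filter_add_card_filter_not]

theorem card_filter_nonNbr_ne_empty_le (S T : Finset V) :
    #(T.filter fun b => nonNbr G b S ≠ ∅) ≤ ∑ b ∈ T, #(nonNbr G b S) := by
  rw [card_filter]
  refine sum_le_sum fun b _ => ?_
  split_ifs with hb
  · exact card_pos.2 (nonempty_iff_ne_empty.2 hb)
  · exact Nat.zero_le _

/-- The vertices of `C` that are incident to a missing edge. -/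
def touched (G : SimpleGraph V) [DecidableRel G.Adj] (C : Finset V) : Finset V :=
  C.filter fun v => nonNbr G v C ≠ ∅

variable {k : ℕ} {C : Finset V}

theorem card_touched_le (hC : IsCliqueSide G C k) : #(touched G C) ≤ 2 * k :=
  (card_filter_nonNbr_ne_empty_le C C).trans hC.2

theorem adj_of_notMem_touched {u v : V} (hv : v ∈ C) (hvt : v ∉ touched G C) (hu : u ∈ C)
    (huv : u ≠ v) : G.Adj v u := by
  by_contra hvu
  exact hvt (mem_filter.2 ⟨hv, ne_empty_of_mem (mem_nonNbr.2 ⟨hu, huv, hvu⟩)⟩)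

variable [Fintype V]

theorem card_mul_pred_add_le_of_mem_free {a : V} (ha : a ∈ free G k) {Y Z : Finset V}
    (hY : Y ⊆ G.neighborFinset a) (hZ : Z ⊆ G.neighborFinset a) (h_disj : Disjoint Y Z)
    (h_indep : G.IsIndepSet Y) :
    #Y * (#Y - 1) + 2 * ∑ b ∈ Y, #(nonNbr G b Z) ≤ 2 * k := by
  have h_free : miss G (G.neighborFinset a) ≤ 2 * k := by
    by_contra! h
    exact (mem_filter.1 ha).2.1
      (mem_filter.2 ⟨mem_univ _, Or.inl (mem_filter.2 ⟨mem_univ _, h⟩)⟩)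
  have h_miss := (miss_mono (union_subset hY hZ)).trans h_free
  rw [miss_union h_disj, miss_of_isIndepSet h_indep] at h_miss
  omega

theorem card_nonNbr_le_of_notMem_forcedOut {b : V} (hb : b ∉ forcedOut G k) {S : Finset V}
    (hSC : S ⊆ C) (hS : Disjoint S (touched G C)) : #(nonNbr G b S) ≤ k + 1 := by
  by_contra! h
  refine hb (mem_filter.2
    ⟨mem_univ _, (Nat.lt_of_succ_lt h).trans_le (card_le_card fun u hu => ?_)⟩)
  refine mem_filter.2 ⟨nonNbr_mono (subset_univ S) b hu, ?_⟩
  have h_erase : k < #((nonNbr G b S).erase u) := by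
    rw [card_erase_of_mem hu]
    omega
  refine h_erase.trans_le (card_le_card fun x hx => ?_)
  obtain ⟨hxu, hx⟩ := mem_erase.1 hx
  have huS := (mem_nonNbr.1 hu).1
  exact mem_filter.2 ⟨nonNbr_mono (subset_univ S) b hx,
    adj_of_notMem_touched (hSC huS) (disjoint_left.1 hS huS) (hSC (mem_nonNbr.1 hx).1) hxu⟩

/-- The free vertices on the clique side `C`. -/
def cliquePart (G : SimpleGraph V) [DecidableRel G.Adj] (k : ℕ) (C : Finset V) : Finset V :=
  free G k ∩ C

/-- The free vertices on the clique side `C` that are incident to no missing edge in `C`. -/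
def untouchedPart (G : SimpleGraph V) [DecidableRel G.Adj] (k : ℕ) (C : Finset V) : Finset V :=
  cliquePart G k C \ touched G C

/-- The linked vertices on the independent side, the complement of `C`. -/
def indepPart (G : SimpleGraph V) [DecidableRel G.Adj] (k : ℕ) (C : Finset V) : Finset V :=
  linked G k \ C

theorem cliquePart_subset : cliquePart G k C ⊆ C := inter_subset_right

theorem untouchedPart_subset : untouchedPart G k C ⊆ cliquePart G k C := sdiff_subset

theorem disjoint_cliquePart_indepPart : Disjoint (cliquePart G k C) (indepPart G k C) :=
  disjoint_sdiff.mono_left cliquePart_subset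

theorem notMem_cliquePart {b : V} (hb : b ∈ indepPart G k C) : b ∉ cliquePart G k C :=
  disjoint_right.1 disjoint_cliquePart_indepPart hb

theorem isIndepSet_indepPart (hC : IsCliqueSide G C k) : G.IsIndepSet (indepPart G k C) :=
  fun u hu v hv _ => hC.1 u (mem_sdiff.1 hu).2 v (mem_sdiff.1 hv).2

theorem exists_adj_of_mem_indepPart (hC : IsCliqueSide G C k) {b : V}
    (hb : b ∈ indepPart G k C) : ∃ a ∈ cliquePart G k C, G.Adj a b := by
  obtain ⟨hb_linked, hbC⟩ := mem_sdiff.1 hb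
  obtain ⟨a, hba, ha⟩ := (mem_filter.1 hb_linked).2
  refine ⟨a, mem_inter.2 ⟨ha, ?_⟩, hba.symm⟩
  by_contra haC
  exact hC.1 b hbC a haC hba

theorem card_cliquePart_le (hC : IsCliqueSide G C k) :
    #(cliquePart G k C) ≤ #(untouchedPart G k C) + 2 * k :=
  card_le_card_sdiff_add_card.trans (Nat.add_le_add_left (card_touched_le hC) _)

theorem card_core_le_cliquePart_add :
    #(core G k) ≤ #(cliquePart G k C) + #(indepPart G k C) := by
  refine (card_le_card fun v hv => ?_).trans (card_union_le _ _)
  have hv := core_subset_linked hv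
  by_cases hvC : v ∈ C
  · exact mem_union_left _ (mem_inter.2 ⟨linked_subset_free hv, hvC⟩)
  · exact mem_union_right _ (mem_sdiff.2 ⟨hv, hvC⟩)

theorem exists_not_adj_of_mem_core (hC : IsCliqueSide G C k) {v : V} (hv : v ∈ core G k)
    (hvC : v ∈ C) (hvt : v ∉ touched G C) : ∃ b ∈ indepPart G k C, ¬ G.Adj v b := by
  rcases (mem_filter.1 hv).2 with hw | ⟨u, huv, hu, hvu⟩
  · obtain ⟨u, hu⟩ := card_pos.1 hw
    obtain ⟨hu, huv, hvu⟩ := mem_nonNbr.1 hu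
    exact absurd (adj_of_notMem_touched hvC hvt (mem_of_mem_forcedIn hC hu) huv) hvu
  · exact ⟨u, mem_sdiff.2 ⟨hu, fun huC => hvu (adj_of_notMem_touched hvC hvt huC huv)⟩, hvu⟩

theorem card_core_le_untouchedPart_add (hC : IsCliqueSide G C k) :
    #(core G k) ≤ 2 * k +
      #((untouchedPart G k C).filter fun a => ∃ b ∈ indepPart G k C, ¬ G.Adj a b) +
        #(indepPart G k C) := by
  have h_cover : core G k ⊆ touched G C ∪
      (untouchedPart G k C).filter (fun a => ∃ b ∈ indepPart G k C, ¬ G.Adj a b) ∪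
        indepPart G k C := by
    intro v hv
    have hv_linked := core_subset_linked hv
    by_cases hvC : v ∈ C
    · refine mem_union_left _ (mem_union.2 (or_iff_not_imp_left.2 fun hvt => mem_filter.2 ?_))
      exact ⟨mem_sdiff.2 ⟨mem_inter.2 ⟨linked_subset_free hv_linked, hvC⟩, hvt⟩,
        exists_not_adj_of_mem_core hC hv hvC hvt⟩
    · exact mem_union_right _ (mem_sdiff.2 ⟨hv_linked, hvC⟩)
  refine (card_le_card h_cover).trans ((card_union_le _ _).trans ?_)
  gcongr
  exact (card_union_le _ _).trans (Nat.add_le_add_right (card_touched_le hC) _)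

theorem card_mul_pred_add_sum_le (hC : IsCliqueSide G C k) {a : V} (ha : a ∈ cliquePart G k C) :
    #((indepPart G k C).filter (G.Adj a)) * (#((indepPart G k C).filter (G.Adj a)) - 1) +
      2 * ∑ b ∈ (indepPart G k C).filter (G.Adj a),
        #(nonNbr G b ((cliquePart G k C).filter (G.Adj a))) ≤ 2 * k :=
  card_mul_pred_add_le_of_mem_free (mem_inter.1 ha).1 (filter_adj_subset_neighborFinset a _)
    (filter_adj_subset_neighborFinset a _)
    (disjoint_cliquePart_indepPart.symm.mono (filter_subset _ _) (filter_subset _ _))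
    ((isIndepSet_indepPart hC).mono (coe_subset.2 (filter_subset _ _)))

theorem sum_card_nonNbr_filter_le (hC : IsCliqueSide G C k) {a : V} (ha : a ∈ cliquePart G k C) :
    ∑ b ∈ (indepPart G k C).filter (G.Adj a),
      #(nonNbr G b ((cliquePart G k C).filter (G.Adj a))) ≤ k := by
  have := card_mul_pred_add_sum_le hC ha
  omega

theorem card_indepPart_le_of_mem {S : Finset V} (hS : S ⊆ cliquePart G k C) {a : V} (ha : a ∈ S) :
    #(indepPart G k C) ≤ #((indepPart G k C).filter (G.Adj a)) +
      #((indepPart G k C).filter fun b => nonNbr G b S ≠ ∅) := by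
  rw [← card_filter_add_card_filter_not (s := indepPart G k C) (fun b => nonNbr G b S = ∅)]
  gcongr ?_ + _
  refine card_le_card fun b hb => ?_
  obtain ⟨hb, hbS⟩ := mem_filter.1 hb
  refine mem_filter.2 ⟨hb, ?_⟩
  by_contra hab
  exact ne_empty_of_mem (mem_nonNbr.2 ⟨ha, ne_of_mem_of_not_mem (hS ha) (notMem_cliquePart hb),
    fun hba => hab hba.symm⟩) hbS

theorem card_filter_not_adj_le :
    #((untouchedPart G k C).filter fun a => ∃ b ∈ indepPart G k C, ¬ G.Adj a b) ≤
      ∑ b ∈ indepPart G k C, #(nonNbr G b (untouchedPart G k C)) := by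
  refine (card_le_card fun a ha => ?_).trans card_biUnion_le
  obtain ⟨ha, b, hb, hab⟩ := mem_filter.1 ha
  exact mem_biUnion.2 ⟨b, hb, mem_nonNbr.2 ⟨ha,
    ne_of_mem_of_not_mem (untouchedPart_subset ha) (notMem_cliquePart hb), fun h => hab h.symm⟩⟩

theorem sum_mul_card_nonNbr_untouchedPart_le (hC : IsCliqueSide G C k) :
    ∑ b ∈ indepPart G k C,
      #((untouchedPart G k C).filter (G.Adj b)) * #(nonNbr G b (untouchedPart G k C)) ≤
        #(untouchedPart G k C) * k := by
  rw [← sum_sum_filter_adj, ← smul_eq_mul]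
  refine sum_le_card_nsmul _ _ _ fun a ha => le_trans ?_
    (sum_card_nonNbr_filter_le hC (untouchedPart_subset ha))
  refine sum_le_sum fun b hb => card_le_card fun u hu => ?_
  obtain ⟨hu, hub, hbu⟩ := mem_nonNbr.1 hu
  have hua : u ≠ a := fun hua => hbu (hua ▸ (mem_filter.1 hb).2.symm)
  refine mem_nonNbr.2 ⟨mem_filter.2 ⟨untouchedPart_subset hu, ?_⟩, hub, hbu⟩
  exact adj_of_notMem_touched (cliquePart_subset (untouchedPart_subset ha)) (mem_sdiff.1 ha).2
    (cliquePart_subset (untouchedPart_subset hu)) hua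

theorem card_nonNbr_cliquePart_le {a b : V} (hab : G.Adj a b) :
    #(nonNbr G b (cliquePart G k C)) ≤
      #(nonNbr G b ((cliquePart G k C).filter (G.Adj a))) + #(nonNbr G a (cliquePart G k C)) := by
  refine (card_le_card fun u hu => ?_).trans (card_union_le _ _)
  obtain ⟨hu, hub, hbu⟩ := mem_nonNbr.1 hu
  by_cases hau : G.Adj a u
  · exact mem_union_left _ (mem_nonNbr.2 ⟨mem_filter.2 ⟨hu, hau⟩, hub, hbu⟩)
  · exact mem_union_right _ (mem_nonNbr.2 ⟨hu, fun hua => hbu (hua ▸ hab.symm), hau⟩)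

theorem sum_mul_card_nonNbr_cliquePart_le (hC : IsCliqueSide G C k) {p : ℕ}
    (hp : ∀ a ∈ cliquePart G k C, #((indepPart G k C).filter (G.Adj a)) ≤ p) :
    ∑ b ∈ indepPart G k C,
      #((cliquePart G k C).filter (G.Adj b)) * #(nonNbr G b (cliquePart G k C)) ≤
        k * (#(cliquePart G k C) + 2 * p) := by
  rw [← sum_sum_filter_adj]
  have h_vertex : ∀ a ∈ cliquePart G k C,
      ∑ b ∈ (indepPart G k C).filter (G.Adj a), #(nonNbr G b (cliquePart G k C)) ≤
        k + p * #(nonNbr G a (cliquePart G k C)) := fun a ha => by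
    refine (sum_le_sum fun b hb => card_nonNbr_cliquePart_le (mem_filter.1 hb).2).trans ?_
    rw [sum_add_distrib, sum_const, smul_eq_mul]
    exact Nat.add_le_add (sum_card_nonNbr_filter_le hC ha) (Nat.mul_le_mul_right _ (hp a ha))
  have h_miss : ∑ a ∈ cliquePart G k C, #(nonNbr G a (cliquePart G k C)) ≤ 2 * k :=
    (miss_mono cliquePart_subset).trans hC.2
  calc
    _ ≤ ∑ a ∈ cliquePart G k C, (k + p * #(nonNbr G a (cliquePart G k C))) :=
      sum_le_sum h_vertex
    _ = #(cliquePart G k C) * k + p * ∑ a ∈ cliquePart G k C, #(nonNbr G a (cliquePart G k C)) := by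
      rw [sum_add_distrib, sum_const, smul_eq_mul, mul_sum]
    _ ≤ #(cliquePart G k C) * k + p * (2 * k) := by gcongr
    _ = k * (#(cliquePart G k C) + 2 * p) := by ring

theorem card_filter_adj_le (hC : IsCliqueSide G C k) {a : V} (ha : a ∈ cliquePart G k C) :
    #((indepPart G k C).filter (G.Adj a)) ≤ k + 1 :=
  le_add_one_of_mul_pred_le ((Nat.le_add_right _ _).trans (card_mul_pred_add_sum_le hC ha))

theorem sum_card_nonNbr_untouchedPart_le (hC : IsCliqueSide G C k)
    (h_large : 2 * k + 2 ≤ #(untouchedPart G k C)) :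
    ∑ b ∈ indepPart G k C, #(nonNbr G b (untouchedPart G k C)) ≤ 2 * k := by
  refine Nat.le_of_mul_le_mul_left (c := #(untouchedPart G k C)) ?_ (by omega)
  have h_half : ∀ b ∈ indepPart G k C,
      #(untouchedPart G k C) ≤ 2 * #((untouchedPart G k C).filter (G.Adj b)) := fun b hb => by
    have h_add := card_filter_adj_add_card_nonNbr (G := G)
      (fun h => notMem_cliquePart hb (untouchedPart_subset (C := C) h))
    have h_few := card_nonNbr_le_of_notMem_forcedOut
      (mem_filter.1 (linked_subset_free (mem_sdiff.1 hb).1)).2.2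
      (untouchedPart_subset.trans (cliquePart_subset (G := G) (k := k) (C := C))) sdiff_disjoint
    omega
  rw [mul_sum]
  refine (sum_le_sum fun b hb => Nat.mul_le_mul_right _ (h_half b hb)).trans ?_
  simp only [mul_assoc, ← mul_sum]
  linarith [sum_mul_card_nonNbr_untouchedPart_le hC]

theorem card_core_le_of_large (hC : IsCliqueSide G C k)
    (h_large : 2 * k + 2 ≤ #(untouchedPart G k C)) : #(core G k) ≤ 9 * k + 1 := by
  obtain ⟨a, ha⟩ := card_pos.1 (by omega : 0 < #(untouchedPart G k C))
  have h_deg := card_filter_adj_le hC (untouchedPart_subset ha)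
  have h_sum := sum_card_nonNbr_untouchedPart_le hC h_large
  have h_touched := card_filter_nonNbr_ne_empty_le (G := G) (untouchedPart G k C)
    (indepPart G k C)
  have h_indep := card_indepPart_le_of_mem untouchedPart_subset ha
  have h_filter := card_filter_not_adj_le (G := G) (k := k) (C := C)
  have h_core := card_core_le_untouchedPart_add hC
  omega

theorem card_indepPart_le_mul (hC : IsCliqueSide G C k) {p : ℕ}
    (hp : ∀ a ∈ cliquePart G k C, #((indepPart G k C).filter (G.Adj a)) ≤ p) :
    #(indepPart G k C) ≤ #(cliquePart G k C) * p := by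
  refine (card_le_card fun b hb => ?_).trans (card_biUnion_le_card_mul (cliquePart G k C) _ p hp)
  obtain ⟨a, ha, hab⟩ := exists_adj_of_mem_indepPart hC hb
  exact mem_biUnion.2 ⟨a, ha, mem_filter.2 ⟨hb, hab⟩⟩

theorem card_filter_nonNbr_ne_empty_mul_le (hC : IsCliqueSide G C k) :
    #((indepPart G k C).filter fun b => nonNbr G b (cliquePart G k C) ≠ ∅) *
        (#(cliquePart G k C) - 1) ≤
      ∑ b ∈ indepPart G k C,
        #((cliquePart G k C).filter (G.Adj b)) * #(nonNbr G b (cliquePart G k C)) := by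
  rw [← smul_eq_mul, ← sum_const, sum_filter]
  refine sum_le_sum fun b hb => ?_
  split_ifs with h_ne
  · obtain ⟨a, ha, hab⟩ := exists_adj_of_mem_indepPart hC hb
    have h_pos : 0 < #((cliquePart G k C).filter (G.Adj b)) :=
      card_pos.2 ⟨a, mem_filter.2 ⟨ha, hab.symm⟩⟩
    rw [← card_filter_adj_add_card_nonNbr (G := G) (notMem_cliquePart hb), Nat.sub_le_iff_le_add]
    have h_pos' := card_pos.2 (nonempty_iff_ne_empty.2 h_ne)
    nlinarith
  · exact Nat.zero_le _

theorem add_le_five_mul {m p x k : ℕ} (hk : 0 < k) (hp : 0 < p) (hpm : p < m)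
    (hpk : p ≤ k + 1) (hx : x * (m - 1) ≤ k * (m + 2 * p)) : p + x ≤ 5 * k := by
  obtain ⟨m, rfl⟩ := Nat.exists_eq_add_one_of_ne_zero (by omega : m ≠ 0)
  rw [Nat.add_sub_cancel] at hx
  rcases (show p = 1 ∨ 2 ≤ p by omega) with rfl | hp
  · have : x ≤ 4 * k := by
      refine Nat.le_of_mul_le_mul_right (c := m) ?_ (by omega)
      nlinarith
    omega
  · have : 2 * x ≤ 7 * k := by
      refine Nat.le_of_mul_le_mul_right (c := m) ?_ (by omega)
      have : k * (2 * (m + 1 + 2 * p)) ≤ k * (7 * m) := Nat.mul_le_mul_left k (by omega)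
      linarith
    omega

theorem card_indepPart_le_of_lt (hC : IsCliqueSide G C k) (hk : 0 < k) {p : ℕ}
    (hp : ∀ a ∈ cliquePart G k C, #((indepPart G k C).filter (G.Adj a)) ≤ p) (hp_pos : 0 < p)
    (hpk : p ≤ k + 1) (h_lt : p < #(cliquePart G k C)) : #(indepPart G k C) ≤ 5 * k := by
  obtain ⟨a, ha⟩ := card_pos.1 (by omega : 0 < #(cliquePart G k C))
  refine (card_indepPart_le_of_mem subset_rfl ha).trans
    ((Nat.add_le_add_right (hp a ha) _).trans (add_le_five_mul hk hp_pos h_lt hpk ?_))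
  exact (card_filter_nonNbr_ne_empty_mul_le hC).trans (sum_mul_card_nonNbr_cliquePart_le hC hp)

theorem card_core_zero_le (hC : IsCliqueSide G C 0) (h_small : #(untouchedPart G 0 C) ≤ 1) :
    #(core G 0) ≤ 1 := by
  have h_clique : #(cliquePart G 0 C) ≤ 1 := (card_cliquePart_le hC).trans h_small
  have h_indep : #(indepPart G 0 C) ≤ 1 :=
    (card_indepPart_le_mul hC fun a => card_filter_adj_le hC).trans
      (Nat.mul_le_mul_right 1 h_clique)
  have h_filter :
      (untouchedPart G 0 C).filter (fun a => ∃ b ∈ indepPart G 0 C, ¬ G.Adj a b) = ∅ := by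
    rw [filter_eq_empty_iff]
    rintro a ha ⟨b, hb, hab⟩
    obtain ⟨a', ha', hab'⟩ := exists_adj_of_mem_indepPart hC hb
    exact hab (card_le_one.1 h_clique a (untouchedPart_subset ha) a' ha' ▸ hab')
  have h_core := card_core_le_untouchedPart_add hC
  rw [h_filter, card_empty] at h_core
  omega

theorem card_core_le_of_small (hC : IsCliqueSide G C k)
    (h_small : #(untouchedPart G k C) ≤ 2 * k + 1) : #(core G k) ≤ 9 * k + 1 := by
  obtain rfl | hk := Nat.eq_zero_or_pos k
  · exact card_core_zero_le hC h_small
  have h_clique := card_cliquePart_le hC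
  have h_add := card_core_le_cliquePart_add (G := G) (k := k) (C := C)
  obtain hB | ⟨b, hb⟩ := (indepPart G k C).eq_empty_or_nonempty
  · rw [hB, card_empty] at h_add
    omega
  obtain ⟨a₀, ha₀, hab⟩ := exists_adj_of_mem_indepPart hC hb
  obtain ⟨a, ha, h_max⟩ := exists_max_image (cliquePart G k C)
    (fun a => #((indepPart G k C).filter (G.Adj a))) ⟨a₀, ha₀⟩
  have h_pos : 0 < #((indepPart G k C).filter (G.Adj a)) :=
    (card_pos.2 ⟨b, mem_filter.2 ⟨hb, hab⟩⟩).trans_le (h_max a₀ ha₀)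
  have h_sq := (Nat.le_add_right _ _).trans (card_mul_pred_add_sum_le hC ha)
  have h_deg := card_filter_adj_le hC ha
  have h_mul := card_indepPart_le_mul hC h_max
  have h_lt := card_indepPart_le_of_lt hC hk h_max h_pos h_deg
  set p := #((indepPart G k C).filter (G.Adj a))
  rcases Nat.lt_or_ge p #(cliquePart G k C) with h | h
  · have h_filter := card_filter_le (untouchedPart G k C)
      fun a => ∃ b ∈ indepPart G k C, ¬ G.Adj a b
    have h_core := card_core_le_untouchedPart_add hC
    have := h_lt h
    omega
  · have h_pp := h_mul.trans (Nat.mul_le_mul_right p h)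
    obtain ⟨q, hq⟩ := Nat.exists_eq_add_one_of_ne_zero h_pos.ne'
    rw [hq, Nat.add_sub_cancel] at h_sq
    rw [hq] at h_pp h h_deg
    nlinarith

theorem card_core_le (hC : IsCliqueSide G C k) : #(core G k) ≤ 9 * k + 1 := by
  rcases Nat.lt_or_ge #(untouchedPart G k C) (2 * k + 2) with h | h
  · exact card_core_le_of_small hC (Nat.le_of_lt_succ h)
  · exact card_core_le_of_large hC h

end Count

/-! ### The kernel -/

noncomputable instance (I : GraphInstance) : DecidableRel I.graph.Adj := Classical.decRel _

/-- An instance of `SplitAddition` without solutions: two disjoint edges and the parameter `0`. -/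
def noInstance : GraphInstance where
  n := 4
  graph :=
    { Adj u v := (u : ℕ) + v = 3
      symm := ⟨fun u v h => (add_comm (v : ℕ) u).trans h⟩
      loopless := ⟨fun u h => by omega⟩ }
  k := 0

/-- The vertices of the gadget for the core of `I`. -/
noncomputable abbrev KernelVertex (I : GraphInstance) : Type :=
  core I.graph I.k ⊕ Fin (I.k + 1) ⊕ Fin (I.k + 2)

/-- The gadget for the core of `I`. -/
noncomputable abbrev kernelGraph (I : GraphInstance) : SimpleGraph (KernelVertex I) :=
  gadget (coreGraph I.graph I.k) (fun v => weight I.graph I.k v) I.k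

/-- The numbering of the vertices of the gadget: the core comes first, in increasing order. -/
noncomputable def kernelEquiv (I : GraphInstance) :
    KernelVertex I ≃ Fin (#(core I.graph I.k) + ((I.k + 1) + (I.k + 2))) :=
  (Equiv.sumCongr ((core I.graph I.k).orderIsoOfFin rfl).symm.toEquiv finSumFinEquiv).trans
    finSumFinEquiv

/-- The instance that consists of the gadget for the core of `I`, and of what remains of the
parameter after the vertices of `forcedIn` have been made a clique. -/
noncomputable def reducedInstance (I : GraphInstance) : GraphInstance where
  n := #(core I.graph I.k) + ((I.k + 1) + (I.k + 2))
  graph := (kernelGraph I).map (kernelEquiv I).toEmbedding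
  k := I.k - miss I.graph (forcedIn I.graph I.k) / 2

/-- The bounds on the core and on `forcedIn` that hold if `I` has a solution. -/
def IsReducible (I : GraphInstance) : Prop :=
  #(core I.graph I.k) ≤ 9 * I.k + 1 ∧ miss I.graph (forcedIn I.graph I.k) ≤ 2 * I.k

noncomputable instance : DecidablePred IsReducible := fun _ => inferInstanceAs (Decidable (_ ∧ _))

/-- The kernel for `SplitAddition`. -/
noncomputable def kernel (I : GraphInstance) : GraphInstance :=
  if IsReducible I then reducedInstance I else noInstance

theorem splitAddition_iff (I : GraphInstance) :
    SplitAddition I ↔ ∃ C, IsCliqueSide I.graph C I.k :=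
  ⟨fun ⟨_, _, hF, h⟩ => exists_isCliqueSide_of_edges hF h, fun ⟨_, hC⟩ => hC.exists_edges⟩

theorem not_splitAddition_noInstance : ¬ SplitAddition noInstance := by
  rw [splitAddition_iff]
  rintro ⟨C, hC⟩
  have h_edge (u v : Fin 4) (huv : (u : ℕ) + v = 3) : u ∈ C ∨ v ∈ C := by
    by_contra! h
    exact hC.1 u h.1 v h.2 huv
  have h_adj {u v : Fin 4} (hu : u ∈ C) (hv : v ∈ C) (huv : v ≠ u) : (u : ℕ) + v = 3 := by
    by_contra h
    exact (hC.card_nonNbr_le hu).not_gt (card_pos.2 ⟨v, mem_nonNbr.2 ⟨hv, huv, h⟩⟩)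
  rcases h_edge 0 3 rfl with h | h <;> rcases h_edge 1 2 rfl with h' | h' <;>
    exact absurd (h_adj h h' (by decide)) (by decide)

theorem splitAddition_reducedInstance_iff {I : GraphInstance}
    (h_forced : miss I.graph (forcedIn I.graph I.k) ≤ 2 * I.k) :
    SplitAddition (reducedInstance I) ↔ SplitAddition I := by
  rw [splitAddition_iff, splitAddition_iff, exists_isCliqueSide_iff_core h_forced,
    ← exists_isCliqueSide_gadget_iff (Nat.sub_le _ _)]
  exact (exists_isCliqueSide_congr (H := (reducedInstance I).graph)
    (SimpleGraph.Iso.map (kernelEquiv I) (kernelGraph I)) _).symm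

theorem IsReducible.of_splitAddition {I : GraphInstance} (hI : SplitAddition I) :
    IsReducible I := by
  obtain ⟨C, hC⟩ := (splitAddition_iff I).1 hI
  exact ⟨card_core_le hC, miss_forcedIn_le hC⟩

theorem splitAddition_kernel_iff (I : GraphInstance) :
    SplitAddition (kernel I) ↔ SplitAddition I := by
  unfold kernel
  split_ifs with h
  · exact splitAddition_reducedInstance_iff h.2
  · exact iff_of_false not_splitAddition_noInstance fun hI => h (.of_splitAddition hI)

theorem kernel_n_le (I : GraphInstance) : (kernel I).n ≤ 11 * I.k + 4 := by
  unfold kernel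
  split_ifs with h
  · have := h.1
    dsimp only [reducedInstance]
    omega
  · exact Nat.le_add_left 4 _

theorem kernel_k_le (I : GraphInstance) : (kernel I).k ≤ I.k := by
  unfold kernel
  split_ifs with h
  exacts [Nat.sub_le _ _, Nat.zero_le _]

/-! ### The kernel is computable in polynomial time -/

section Computability

open PolyTimeComputation Context

variable {J : GraphInstance → GraphInstance} {Γ : Type} [Context Γ]
  {S : (γ : Γ) → Finset (Fin (J (inst γ)).n)} {u v : (γ : Γ) → Fin (J (inst γ)).n}

theorem polyTimePred_adj (hJ : PolyTimeTransform J) (hu : PolyTime fun γ => (u γ : ℕ))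
    (hv : PolyTime fun γ => (v γ : ℕ)) :
    PolyTimePred fun γ => (J (inst γ)).graph.Adj (u γ) (v γ) :=
  (hJ.adj hu hv).of_iff fun _ => natAdj_val.symm

theorem polyTimePred_eq (hu : PolyTime fun γ => (u γ : ℕ)) (hv : PolyTime fun γ => (v γ : ℕ)) :
    PolyTimePred fun γ => u γ = v γ :=
  (hu.eq hv).of_iff fun _ => Fin.ext_iff

theorem polyTimePred_mem_nonNbr (hJ : PolyTimeTransform J) (hu : PolyTime fun γ => (u γ : ℕ))
    (hv : PolyTime fun γ => (v γ : ℕ)) (hS : PolyTimePred fun γ => u γ ∈ S γ) :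
    PolyTimePred fun γ => u γ ∈ nonNbr (J (inst γ)).graph (v γ) (S γ) :=
  (hS.and ((polyTimePred_eq hu hv).not.and (polyTimePred_adj hJ hv hu).not)).of_iff
    fun _ => mem_nonNbr

theorem polyTime_card_nonNbr (hJ : PolyTimeTransform J) (hv : PolyTime fun γ => (v γ : ℕ))
    (hS : PolyTimePred fun x : Σ γ, Fin (J (inst γ)).n => x.2 ∈ S x.1) :
    PolyTime fun γ => #(nonNbr (J (inst γ)).graph (v γ) (S γ)) :=
  hJ.n.comp_inst.card (polyTimePred_mem_nonNbr hJ hJ.n.comp_inst.snd (hv.comp_fst _) hS)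

theorem polyTime_miss (hJ : PolyTimeTransform J)
    (hS : PolyTimePred fun x : Σ γ, Fin (J (inst γ)).n => x.2 ∈ S x.1)
    (hS' : PolyTimePred fun x : Σ y : Σ γ, Fin (J (inst γ)).n, Fin (J (inst y)).n =>
      x.2 ∈ S x.1.1) :
    PolyTime fun γ => miss (J (inst γ)).graph (S γ) :=
  hJ.n.comp_inst.sum_mem hS (polyTime_card_nonNbr hJ hJ.n.comp_inst.snd hS')

theorem polyTimePred_mem_neighborFinset (hJ : PolyTimeTransform J)
    (hu : PolyTime fun γ => (u γ : ℕ)) (hv : PolyTime fun γ => (v γ : ℕ)) :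
    PolyTimePred fun γ => u γ ∈ (J (inst γ)).graph.neighborFinset (v γ) :=
  (polyTimePred_adj hJ hv hu).of_iff fun _ => SimpleGraph.mem_neighborFinset _ _ _

theorem polyTimePred_mem_denseForced (hJ : PolyTimeTransform J)
    (hv : PolyTime fun γ => (v γ : ℕ)) :
    PolyTimePred fun γ => v γ ∈ denseForced (J (inst γ)).graph (J (inst γ)).k :=
  (((PolyTime.const 2).mul hJ.k.comp_inst).lt (polyTime_miss hJ
    (polyTimePred_mem_neighborFinset hJ hJ.n.comp_inst.snd (hv.comp_fst _))
    (polyTimePred_mem_neighborFinset hJ hJ.n.comp_inst.snd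
      ((hv.comp_fst _).comp_fst _)))).of_iff fun _ => mem_filter_univ _

theorem polyTimePred_mem_nonNbr_univ (hJ : PolyTimeTransform J)
    (hu : PolyTime fun γ => (u γ : ℕ)) (hv : PolyTime fun γ => (v γ : ℕ)) :
    PolyTimePred fun γ => u γ ∈ nonNbr (J (inst γ)).graph (v γ) univ :=
  polyTimePred_mem_nonNbr hJ hu hv (((PolyTime.const 0).eq (.const 0)).of_iff fun _ => by simp)

theorem polyTimePred_mem_forcedOut (hJ : PolyTimeTransform J)
    (hv : PolyTime fun γ => (v γ : ℕ)) :
    PolyTimePred fun γ => v γ ∈ forcedOut (J (inst γ)).graph (J (inst γ)).k := by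
  have hn {Δ : Type} [Context Δ] : PolyTime fun δ : Δ => (J (inst δ)).n := hJ.n.comp_inst
  have hk {Δ : Type} [Context Δ] : PolyTime fun δ : Δ => (J (inst δ)).k := hJ.k.comp_inst
  have h_inner : PolyTime fun x : Σ γ, Fin (J (inst γ)).n =>
      #((nonNbr (J (inst x.1)).graph (v x.1) univ).filter ((J (inst x.1)).graph.Adj x.2)) :=
    hn.card (((polyTimePred_mem_nonNbr_univ hJ hn.snd ((hv.comp_fst _).comp_fst _)).and
      (polyTimePred_adj hJ (hn.snd.comp_fst _) hn.snd)).of_iff fun _ => mem_filter)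
  exact (hk.lt (hn.card (((polyTimePred_mem_nonNbr_univ hJ hn.snd (hv.comp_fst _)).and
    (hk.lt h_inner)).of_iff fun _ => mem_filter))).of_iff fun _ => mem_filter_univ _

theorem polyTimePred_mem_forcedIn (hJ : PolyTimeTransform J)
    (hv : PolyTime fun γ => (v γ : ℕ)) :
    PolyTimePred fun γ => v γ ∈ forcedIn (J (inst γ)).graph (J (inst γ)).k :=
  ((polyTimePred_mem_denseForced hJ hv).or (hJ.n.comp_inst.exists_fin
    ((polyTimePred_adj hJ (hv.comp_fst _) hJ.n.comp_inst.snd).and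
      (polyTimePred_mem_forcedOut hJ hJ.n.comp_inst.snd)))).of_iff fun _ => mem_forcedIn

theorem polyTimePred_mem_free (hJ : PolyTimeTransform J) (hv : PolyTime fun γ => (v γ : ℕ)) :
    PolyTimePred fun γ => v γ ∈ free (J (inst γ)).graph (J (inst γ)).k :=
  ((polyTimePred_mem_forcedIn hJ hv).not.and (polyTimePred_mem_forcedOut hJ hv).not).of_iff
    fun _ => mem_filter_univ _

theorem polyTimePred_mem_linked (hJ : PolyTimeTransform J) (hv : PolyTime fun γ => (v γ : ℕ)) :
    PolyTimePred fun γ => v γ ∈ linked (J (inst γ)).graph (J (inst γ)).k :=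
  ((polyTimePred_mem_free hJ hv).and (hJ.n.comp_inst.exists_fin
    ((polyTimePred_adj hJ (hv.comp_fst _) hJ.n.comp_inst.snd).and
      (polyTimePred_mem_free hJ hJ.n.comp_inst.snd)))).of_iff fun _ => mem_linked

theorem polyTime_weight (hJ : PolyTimeTransform J) (hv : PolyTime fun γ => (v γ : ℕ)) :
    PolyTime fun γ => weight (J (inst γ)).graph (J (inst γ)).k (v γ) :=
  polyTime_card_nonNbr hJ hv (polyTimePred_mem_forcedIn hJ hJ.n.comp_inst.snd)

theorem polyTimePred_mem_core (hJ : PolyTimeTransform J) (hv : PolyTime fun γ => (v γ : ℕ)) :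
    PolyTimePred fun γ => v γ ∈ core (J (inst γ)).graph (J (inst γ)).k := by
  have hn {Δ : Type} [Context Δ] : PolyTime fun δ : Δ => (J (inst δ)).n := hJ.n.comp_inst
  have h_unlinked : PolyTimePred fun γ => ∃ u, u ≠ v γ ∧
      u ∈ linked (J (inst γ)).graph (J (inst γ)).k ∧ ¬ (J (inst γ)).graph.Adj (v γ) u :=
    hn.exists_fin ((polyTimePred_eq hn.snd (hv.comp_fst _)).not.and
      ((polyTimePred_mem_linked hJ hn.snd).and (polyTimePred_adj hJ (hv.comp_fst _) hn.snd).not))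
  exact ((polyTimePred_mem_linked hJ hv).and (((PolyTime.const 0).lt (polyTime_weight hJ hv)).or
    h_unlinked)).of_iff fun _ => mem_core

theorem polyTime_card_core (hJ : PolyTimeTransform J) :
    PolyTime fun γ : Γ => #(core (J (inst γ)).graph (J (inst γ)).k) :=
  hJ.n.comp_inst.card (polyTimePred_mem_core hJ hJ.n.comp_inst.snd)

theorem polyTime_miss_forcedIn (hJ : PolyTimeTransform J) :
    PolyTime fun γ : Γ => miss (J (inst γ)).graph (forcedIn (J (inst γ)).graph (J (inst γ)).k) :=
  polyTime_miss hJ (polyTimePred_mem_forcedIn hJ hJ.n.comp_inst.snd)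
    (polyTimePred_mem_forcedIn hJ hJ.n.comp_inst.snd)

/-- The number of the vertex `v` in the kernel, if `v` belongs to the core. -/
noncomputable def corePos (I : GraphInstance) (v : Fin I.n) : ℕ :=
  #((core I.graph I.k).filter (· < v))

theorem orderIsoOfFin_symm_val {α : Type*} [LinearOrder α] (S : Finset α) (v : S) :
    ((S.orderIsoOfFin rfl).symm v : ℕ) = #(S.filter (· < v.1)) := by
  obtain ⟨i, rfl⟩ := (S.orderIsoOfFin rfl).surjective v
  have h : S.filter (· < S.orderEmbOfFin rfl i) =
      (Iio i).map (S.orderEmbOfFin rfl).toEmbedding := by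
    calc S.filter (· < S.orderEmbOfFin rfl i)
      _ = (univ.map (S.orderEmbOfFin rfl).toEmbedding).filter (· < S.orderEmbOfFin rfl i) := by
        rw [S.map_orderEmbOfFin_univ rfl]
      _ = (Iio i).map (S.orderEmbOfFin rfl).toEmbedding := by
        simp only [filter_map, Function.comp_def, RelEmbedding.coe_toEmbedding,
          OrderEmbedding.lt_iff_lt, filter_gt_eq_Iio]
  rw [coe_orderIsoOfFin_apply, h, card_map, Fin.card_Iio, OrderIso.symm_apply_apply]

theorem polyTime_corePos (hJ : PolyTimeTransform J) (hv : PolyTime fun γ => (v γ : ℕ)) :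
    PolyTime fun γ => corePos (J (inst γ)) (v γ) :=
  hJ.n.comp_inst.card (((polyTimePred_mem_core hJ hJ.n.comp_inst.snd).and
    (hJ.n.comp_inst.snd.lt (hv.comp_fst _))).of_iff fun _ => mem_filter)

theorem natAdj_reducedInstance_iff_exists {I : GraphInstance} {x y : ℕ} :
    NatAdj (reducedInstance I) x y ↔
      ∃ a b, (kernelGraph I).Adj a b ∧ x = kernelEquiv I a ∧ y = kernelEquiv I b := by
  simp only [NatAdj, reducedInstance, SimpleGraph.map_adj]
  constructor
  · rintro ⟨_, _, ⟨a, b, h, rfl, rfl⟩, rfl, rfl⟩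
    exact ⟨a, b, h, rfl, rfl⟩
  · rintro ⟨a, b, h, rfl, rfl⟩
    exact ⟨_, _, ⟨a, b, h, rfl, rfl⟩, rfl, rfl⟩

theorem kernelEquiv_inl {I : GraphInstance} (v : core I.graph I.k) :
    (kernelEquiv I (.inl v) : ℕ) = corePos I v := by
  simp [kernelEquiv, corePos, ← orderIsoOfFin_symm_val]

theorem kernelEquiv_inr_inl {I : GraphInstance} (q : Fin (I.k + 1)) :
    (kernelEquiv I (.inr (.inl q)) : ℕ) = #(core I.graph I.k) + q := by
  simp [kernelEquiv]

theorem kernelEquiv_inr_inr {I : GraphInstance} (r : Fin (I.k + 2)) :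
    (kernelEquiv I (.inr (.inr r)) : ℕ) = #(core I.graph I.k) + (I.k + 1 + r) := by
  simp [kernelEquiv]

/-- The adjacency in `reducedInstance I` of the vertices with the numbers `x` and `y`, where `x`
belongs to no later part of the kernel than `y`. -/
def KernelHalfAdj (I : GraphInstance) (x y : ℕ) : Prop :=
  (∃ u v, ((u ∈ core I.graph I.k ∧ v ∈ core I.graph I.k) ∧ I.graph.Adj u v) ∧
    x = corePos I u ∧ y = corePos I v) ∨
  (∃ (v : Fin I.n) (q : Fin (I.k + 1)), (v ∈ core I.graph I.k ∧ weight I.graph I.k v ≤ q) ∧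
    x = corePos I v ∧ y = #(core I.graph I.k) + q) ∨
  (∃ p q : Fin (I.k + 1), p ≠ q ∧
    x = #(core I.graph I.k) + p ∧ y = #(core I.graph I.k) + q) ∨
  (∃ (q : Fin (I.k + 1)) (r : Fin (I.k + 2)),
    x = #(core I.graph I.k) + q ∧ y = #(core I.graph I.k) + (I.k + 1 + r))

theorem KernelHalfAdj.exists_adj {I : GraphInstance} {x y : ℕ} (h : KernelHalfAdj I x y) :
    ∃ a b, (kernelGraph I).Adj a b ∧ x = kernelEquiv I a ∧ y = kernelEquiv I b := by
  rcases h with ⟨u, v, ⟨⟨hu, hv⟩, huv⟩, rfl, rfl⟩ | ⟨v, q, ⟨hv, hvq⟩, rfl, rfl⟩ |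
    ⟨p, q, hpq, rfl, rfl⟩ | ⟨q, r, rfl, rfl⟩
  · exact ⟨.inl ⟨u, hu⟩, .inl ⟨v, hv⟩, huv, (kernelEquiv_inl ⟨u, hu⟩).symm,
      (kernelEquiv_inl ⟨v, hv⟩).symm⟩
  · exact ⟨.inl ⟨v, hv⟩, .inr (.inl q), hvq, (kernelEquiv_inl ⟨v, hv⟩).symm,
      (kernelEquiv_inr_inl q).symm⟩
  · exact ⟨.inr (.inl p), .inr (.inl q), hpq, (kernelEquiv_inr_inl p).symm,
      (kernelEquiv_inr_inl q).symm⟩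
  · exact ⟨.inr (.inl q), .inr (.inr r), trivial, (kernelEquiv_inr_inl q).symm,
      (kernelEquiv_inr_inr r).symm⟩

theorem natAdj_reducedInstance_iff_kernelHalfAdj {I : GraphInstance} {x y : ℕ} :
    NatAdj (reducedInstance I) x y ↔ KernelHalfAdj I x y ∨ KernelHalfAdj I y x := by
  rw [natAdj_reducedInstance_iff_exists]
  constructor
  · rintro ⟨u | p | r, v | q | s, h, rfl, rfl⟩ <;>
      simp only [kernelEquiv_inl, kernelEquiv_inr_inl, kernelEquiv_inr_inr]
    · exact .inl (.inl ⟨u, v, ⟨⟨u.2, v.2⟩, h⟩, rfl, rfl⟩)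
    · exact .inl (.inr (.inl ⟨u, q, ⟨u.2, h⟩, rfl, rfl⟩))
    · exact h.elim
    · exact .inr (.inr (.inl ⟨v, p, ⟨v.2, h⟩, rfl, rfl⟩))
    · exact .inl (.inr (.inr (.inl ⟨p, q, h, rfl, rfl⟩)))
    · exact .inl (.inr (.inr (.inr ⟨p, s, rfl, rfl⟩)))
    · exact h.elim
    · exact .inr (.inr (.inr (.inr ⟨q, r, rfl, rfl⟩)))
    · exact h.elim
  · rintro (h | h)
    · exact h.exists_adj
    · obtain ⟨a, b, hab, hy, hx⟩ := h.exists_adj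
      exact ⟨b, a, hab.symm, hx, hy⟩

theorem polyTimePred_kernelHalfAdj {f g : Γ → ℕ} (hJ : PolyTimeTransform J) (hf : PolyTime f)
    (hg : PolyTime g) : PolyTimePred fun γ => KernelHalfAdj (J (inst γ)) (f γ) (g γ) := by
  have hn {Δ : Type} [Context Δ] : PolyTime fun δ : Δ => (J (inst δ)).n := hJ.n.comp_inst
  have hk {Δ : Type} [Context Δ] (i : ℕ) : PolyTime fun δ : Δ => (J (inst δ)).k + i :=
    hJ.k.comp_inst.add (.const i)
  have hf₂ {m : Γ → ℕ} {l : (Σ γ, Fin (m γ)) → ℕ} := (hf.comp_fst m).comp_fst l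
  have hg₂ {m : Γ → ℕ} {l : (Σ γ, Fin (m γ)) → ℕ} := (hg.comp_fst m).comp_fst l
  have hc {Δ : Type} [Context Δ] :
      PolyTime fun δ : Δ => #(core (J (inst δ)).graph (J (inst δ)).k) := polyTime_card_core hJ
  have hu {Δ : Type} [Context Δ] {m : (Σ δ : Δ, Fin (J (inst δ)).n) → ℕ} :
      PolyTime fun y : Σ x : Σ δ : Δ, Fin (J (inst δ)).n, Fin (m x) => (y.1.2 : ℕ) :=
    hn.snd.comp_fst m
  refine (hn.exists_fin (hn.exists_fin ?_)).or ((hn.exists_fin ((hk 1).exists_fin ?_)).or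
    (((hk 1).exists_fin ((hk 1).exists_fin ?_)).or ((hk 1).exists_fin ((hk 2).exists_fin ?_))))
  · exact (((polyTimePred_mem_core hJ hu).and (polyTimePred_mem_core hJ hn.snd)).and
      (polyTimePred_adj hJ hu hn.snd)).and
      ((hf₂.eq (polyTime_corePos hJ hu)).and (hg₂.eq (polyTime_corePos hJ hn.snd)))
  · exact ((polyTimePred_mem_core hJ hu).and ((polyTime_weight hJ hu).le (hk 1).snd)).and
      ((hf₂.eq (polyTime_corePos hJ hu)).and (hg₂.eq (hc.add (hk 1).snd)))
  · have hp := ((hk 1).snd.comp_fst fun x : Σ γ : Γ, Fin ((J (inst γ)).k + 1) =>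
      (J (inst x)).k + 1)
    exact ((hp.eq (hk 1).snd).not.of_iff fun _ => not_congr Fin.ext_iff).and
      ((hf₂.eq (hc.add hp)).and (hg₂.eq (hc.add (hk 1).snd)))
  · exact (hf₂.eq (hc.add ((hk 1).snd.comp_fst _))).and
      (hg₂.eq (hc.add ((hk 1).add (hk 2).snd)))

theorem polyTimeTransform_reducedInstance (hJ : PolyTimeTransform J) :
    PolyTimeTransform fun I => reducedInstance (J I) where
  n := (polyTime_card_core hJ).add ((hJ.k.add (.const 1)).add (hJ.k.add (.const 2)))
  k := hJ.k.sub ((polyTime_miss_forcedIn hJ).div (.const 2))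
  adj hf hg := ((polyTimePred_kernelHalfAdj hJ hf hg).or
    (polyTimePred_kernelHalfAdj hJ hg hf)).of_iff fun _ => natAdj_reducedInstance_iff_kernelHalfAdj

theorem natAdj_noInstance_iff {x y : ℕ} : NatAdj noInstance x y ↔ x + y = 3 := by
  constructor
  · rintro ⟨u, v, h, rfl, rfl⟩
    exact h
  · intro h
    exact ⟨⟨x, by dsimp only [noInstance]; omega⟩, ⟨y, by dsimp only [noInstance]; omega⟩, h,
      rfl, rfl⟩

theorem polyTimeTransform_noInstance : PolyTimeTransform fun _ => noInstance where
  n := .const 4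
  k := .const 0
  adj hf hg := ((hf.add hg).eq (.const 3)).of_iff fun _ => natAdj_noInstance_iff

theorem polyTimeTransform_kernel (hJ : PolyTimeTransform J) :
    PolyTimeTransform fun I => kernel (J I) :=
  .ite (((polyTime_card_core hJ).le (((PolyTime.const 9).mul hJ.k).add (.const 1))).and
    ((polyTime_miss_forcedIn hJ).le ((PolyTime.const 2).mul hJ.k)))
    (polyTimeTransform_reducedInstance hJ) polyTimeTransform_noInstance

end Computability

/-! ### The two problems -/

section Problems

open PolyTimeComputation

theorem miss_univ_le {V : Type*} [DecidableEq V] [Fintype V] (G : SimpleGraph V)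
    [DecidableRel G.Adj] : miss G univ ≤ Fintype.card V * Fintype.card V :=
  sum_le_card_nsmul _ _ _ fun v _ => card_le_univ (nonNbr G v univ)

theorem splitAddition_trunc_iff (I : GraphInstance) :
    SplitAddition (trunc I) ↔ SplitAddition I := by
  rw [splitAddition_iff, splitAddition_iff]
  rcases le_total I.k (I.n * I.n) with h | h
  · simp only [trunc, min_eq_left h]
  · have h_univ : ∀ u ∉ (univ : Finset (Fin I.n)), ∀ v ∉ univ, ¬ I.graph.Adj u v :=
      fun u hu => absurd (mem_univ u) hu
    have h_miss := miss_univ_le I.graph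
    rw [Fintype.card_fin] at h_miss
    simp only [trunc, min_eq_right h]
    exact iff_of_true ⟨univ, h_univ, by omega⟩ ⟨univ, h_univ, by omega⟩

theorem isSplitGraph_compl {V : Type*} {G : SimpleGraph V} (h : IsSplitGraph G) :
    IsSplitGraph Gᶜ := by
  obtain ⟨K, hclique, hindep⟩ := h
  exact ⟨Kᶜ, by rwa [SimpleGraph.isClique_compl], by
    rwa [compl_compl, SimpleGraph.isIndepSet_compl]⟩

theorem compl_deleteEdges {V : Type*} (G : SimpleGraph V) (F : Set (Sym2 V)) :
    (G.deleteEdges F)ᶜ = Gᶜ ⊔ SimpleGraph.fromEdgeSet F := by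
  ext u v
  simp only [SimpleGraph.compl_adj, SimpleGraph.deleteEdges_adj, SimpleGraph.sup_adj,
    SimpleGraph.fromEdgeSet_adj]
  tauto

theorem compl_sup_fromEdgeSet {V : Type*} (G : SimpleGraph V) (F : Set (Sym2 V)) :
    (Gᶜ ⊔ SimpleGraph.fromEdgeSet F)ᶜ = G.deleteEdges (F ∩ G.edgeSet) := by
  rw [← compl_deleteEdges, compl_compl, SimpleGraph.deleteEdges_eq_inter_edgeSet]

theorem exists_isSplitGraph_deleteEdges_iff {V : Type*} (G : SimpleGraph V) (k : ℕ) :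
    (∃ F : Finset (Sym2 V), (∀ e ∈ F, e ∈ G.edgeSet) ∧ #F ≤ k ∧
        IsSplitGraph (G.deleteEdges (F : Set (Sym2 V)))) ↔
      ∃ F : Finset (Sym2 V), (∀ e ∈ F, ¬ e.IsDiag) ∧ #F ≤ k ∧
        IsSplitGraph (Gᶜ ⊔ SimpleGraph.fromEdgeSet (F : Set (Sym2 V))) := by
  classical
  constructor
  · rintro ⟨F, hF, h_card, h⟩
    refine ⟨F, fun e he => SimpleGraph.not_isDiag_of_mem_edgeSet _ (hF e he), h_card, ?_⟩
    exact compl_deleteEdges G _ ▸ isSplitGraph_compl h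
  · rintro ⟨F, -, h_card, h⟩
    refine ⟨F.filter (· ∈ G.edgeSet), fun e he => (mem_filter.1 he).2,
      (card_filter_le _ _).trans h_card, ?_⟩
    rw [coe_filter]
    exact compl_sup_fromEdgeSet G _ ▸ isSplitGraph_compl h

theorem splitDeletion_iff (I : GraphInstance) : SplitDeletion I ↔ SplitAddition (compl I) :=
  exists_isSplitGraph_deleteEdges_iff I.graph I.k

theorem admitsKernel_of_polyTimeTransform {Q : GraphInstance → Prop} {f : ℕ → ℝ}
    {T : GraphInstance → GraphInstance} (hT : PolyTimeTransform T) (h_iff : ∀ I, Q (T I) ↔ Q I)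
    (h_n : ∀ I, ((T I).n : ℝ) ≤ f I.k) (h_k : ∀ I, (T I).k ≤ I.k) : AdmitsKernel Q f := by
  obtain ⟨c, p, h⟩ := hT.exists_exec
  refine ⟨c, p, fun I => ?_⟩
  obtain ⟨t, σ, h_exec, ht, h_out⟩ := h I
  exact ⟨T I, t, σ, h_exec, ht, h_out, h_iff I, h_n I, h_k I⟩

theorem kernel_trunc_n_le (I : GraphInstance) : ((kernel (trunc I)).n : ℝ) ≤ 11 * I.k + 4 := by
  have h : (kernel (trunc I)).n ≤ 11 * I.k + 4 :=
    (kernel_n_le _).trans (by gcongr; exact min_le_left _ _)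
  exact_mod_cast h

theorem kernel_trunc_k_le (I : GraphInstance) : (kernel (trunc I)).k ≤ I.k :=
  (kernel_k_le _).trans (min_le_left _ _)

theorem admitsKernel_splitAddition : AdmitsKernel SplitAddition fun k => 11 * (k : ℝ) + 4 :=
  admitsKernel_of_polyTimeTransform (polyTimeTransform_kernel .trunc)
    (fun I => (splitAddition_kernel_iff _).trans (splitAddition_trunc_iff I))
    kernel_trunc_n_le kernel_trunc_k_le

theorem admitsKernel_splitDeletion : AdmitsKernel SplitDeletion fun k => 11 * (k : ℝ) + 4 := by
  have h_iff (I : GraphInstance) :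
      SplitDeletion (compl (kernel (compl (trunc I)))) ↔ SplitDeletion I := by
    rw [splitDeletion_iff, splitDeletion_iff, compl_involutive, splitAddition_kernel_iff]
    exact splitAddition_trunc_iff (compl I)
  exact admitsKernel_of_polyTimeTransform
    (polyTimeTransform_kernel PolyTimeTransform.trunc.compl).compl h_iff
    (fun I => kernel_trunc_n_le (compl I)) fun I => kernel_trunc_k_le (compl I)

end Problems

end SplitKernel

theorem AdmitsKernel.mono {Q : GraphInstance → Prop} {f g : ℕ → ℝ} (hf : AdmitsKernel Q f)
    (h : ∀ k, f k ≤ g k) : AdmitsKernel Q g := by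
  obtain ⟨c, p, hc⟩ := hf
  refine ⟨c, p, fun I => ?_⟩
  obtain ⟨J, t, σ, h_exec, ht, h_out, h_iff, h_n, h_k⟩ := hc I
  exact ⟨J, t, σ, h_exec, ht, h_out, h_iff, h_n.trans (h I.k), h_k⟩

theorem theorem2_general :
    AdmitsKernel SplitAddition (fun k => 11 * (k : ℝ) + 4) ∧
    AdmitsKernel SplitDeletion (fun k => 11 * (k : ℝ) + 4) :=
  ⟨SplitKernel.admitsKernel_splitAddition, SplitKernel.admitsKernel_splitDeletion⟩

theorem theorem2 :
    AdmitsKernel SplitAddition (fun k => 11 * (k : ℝ) + 6 * Real.sqrt (2 * (k : ℝ)) + 4) ∧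
    AdmitsKernel SplitDeletion (fun k => 11 * (k : ℝ) + 6 * Real.sqrt (2 * (k : ℝ)) + 4) := by
  have h (k : ℕ) : 11 * (k : ℝ) + 4 ≤ 11 * k + 6 * Real.sqrt (2 * k) + 4 := by
    linarith [Real.sqrt_nonneg (2 * k)]
  exact ⟨theorem2_general.1.mono h, theorem2_general.2.mono h⟩
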